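/- Let $\mathcal P$ be a probability measure on $\mathbb R$ with finite first moment and mean zero, having a density $f$ with respect to Lebesgue measure. Assume that for every $p\ge 0$ there is a finite constant $C(f,p)>0$ such that, for $X\sim\mathcal P$ and an independent standard Gaussian variable $W$, $$\mathbb E\Bigl[|W|^p\Bigl(1-\frac{f(X+sW)}{f(X)}\Bigr)_+\Bigr]\le C(f,p)\,s\qquad\text{for all } s\ge 0 .$$ For $n\ge 1$ let $I_n=\{(i,j):1\le i<j\le n\}$ and $\mathcal S_n=\{\sigma\in\{+1,-1\}^n:\sigma_1=+1\}$ (spin configurations modulo the global spin flip), with the normalized Hamming metric $d_n(\sigma,\sigma')=\frac1n\,|\{i:\sigma_i\ne\sigma_i'\}|$. For $x\in\mathbb R^{I_n}$ and $\sigma\in\mathcal S_n$ let $$\mathcal H_n(x;\sigma)=-\sum_{1\le i<j\le n}x_{(i,j)}\sigma_i\sigma_j .$$ Then for $\mathcal P^{\otimes I_n}$-almost every $x$ the function $\mathcal H_n(x;\cdot)$ has a unique minimizer $\widehat\sigma_n(x)\in\mathcal S_n$ (the ground state), and the ground state is stable under replacing one disorder variable at a time, in the following sense. For all $\varepsilon,\delta>0$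 there is $M(\varepsilon,\delta)<\infty$ with the following property. For each $n$, let $\mathbf X^n$ be a random vector with law $\mathcal P^{\otimes I_n}$ and, for each $l\in I_n$, let $\mathbf X^{n,l}$ be an independent copy of $\mathbf X^n$ (defined on the same probability space as $\mathbf X^n$; nothing else is assumed about the joint distribution of $\mathbf X^n$ and the $\mathbf X^{n,l}$, $l\in I_n$). Let $\mathbf X^n_l$ be obtained from $\mathbf X^n$ by replacing its $l$-th coordinate by the $l$-th coordinate of $\mathbf X^{n,l}$. Then $$\limsup_{n\to\infty}\ \mathbb P\Bigl[\ \min_{A\subseteq I_n:\ |A|>(1-\varepsilon)|I_n|}\ P\bigl(\{\widehat\sigma_n(\mathbf X^n_l):l\in A\},d_n,\varepsilon\bigr)\ \ge\ M(\varepsilon,\delta)\Bigr]\le\delta ,$$ where the packing number $P(T,d_n,\varepsilon)$ is the largest cardinality of a subset of $T$ any two distinct points of which have $d_n$-distance greater than $\varepsilon$. -/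

import Mathlib

open MeasureTheory ProbabilityTheory Filter
open scoped NNReal ENNReal

universe u

/-! ### Random minimization problems and their stability -/

/-- `ω` attains the minimum of the objective function `ψ` over the parameter space `S`. -/
def IsMinimizer {S : Type} (ψ : S → ℝ) (ω : S) : Prop :=
  ∀ ω' : S, ψ ω ≤ ψ ω'

/-- The optimizer. It is the minimizer of `ψ` whenever there is exactly one, which is the only case
in which its value matters. -/
noncomputable def optimizer {S : Type} [Nonempty S] (ψ : S → ℝ) : S :=
  Classical.epsilon fun ω => IsMinimizer ψ ω

/-- The minimization problem of `ψ x : S → ℝ`, where the input `x : I → 𝒳` consists of i.i.d.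
random variables with law `P`, almost surely has exactly one minimizer. -/
def HasUniqueOptimizer {𝒳 I S : Type} [MeasurableSpace 𝒳] [Fintype I]
    (P : Measure 𝒳) (ψ : (I → 𝒳) → S → ℝ) : Prop :=
  ∀ᵐ x ∂(Measure.pi fun _ : I => P), ∃! ω : S, IsMinimizer (ψ x) ω

open Classical in
/-- The input `x`, with the entries whose index lies in the block `J` replaced by those of `x'`. -/
noncomputable def perturbedInput {𝒳 I : Type} (J : Set I) (x x' : I → 𝒳) : I → 𝒳 :=
  fun i => if i ∈ J then x' i else x i

/-- The least `ε`-packing number of a set `{ω l | l ∈ A}` of solutions, over all sets `A` that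
contain more than a fraction `1 - ε` of the indices. (Packing numbers are those of Mathlib: the
largest cardinality of a subset whose distinct points have distance `> ε`.) -/
noncomputable def minPacking {S L : Type} [MetricSpace S] [Fintype L] (ε : ℝ≥0) (ω : L → S) : ℕ∞ :=
  ⨅ A : {A : Finset L // (1 - (ε : ℝ)) * (Fintype.card L : ℝ) < (A.card : ℝ)},
    Metric.packingNumber ε (ω '' (A.1 : Set L))

/-- The sequence of random minimization problems with parameter spaces `S n`, input index sets
`I n`, objective functions `ψ n` and input law `P` is stable under small perturbations with
perturbation blocks `J n l ⊆ I n`, `l ∈ L n`. Here `X n` is the input of the `n`-th problem and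
`X' n l` is an independent copy of it, for each `l`; nothing else is assumed about the joint
distribution of `X n` and all the `X' n l`. -/
def StableUnderSmallPerturbations {𝒳 : Type} [MeasurableSpace 𝒳] (P : Measure 𝒳)
    (I : ℕ → Type) [∀ n, Fintype (I n)]
    (S : ℕ → Type) [∀ n, MetricSpace (S n)] [∀ n, Nonempty (S n)]
    (ψ : ∀ n, (I n → 𝒳) → S n → ℝ)
    (L : ℕ → Type) [∀ n, Fintype (L n)] (J : ∀ n, L n → Set (I n)) : Prop :=
  ∀ ε δ : ℝ≥0, 0 < ε → 0 < δ → ∃ M : ℕ,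
    ∀ (Ω : ℕ → Type u) [∀ n, MeasurableSpace (Ω n)]
      (μ : ∀ n, Measure (Ω n)) [∀ n, IsProbabilityMeasure (μ n)]
      (X : ∀ n, Ω n → I n → 𝒳) (X' : ∀ n, L n → Ω n → I n → 𝒳),
      (∀ n, HasLaw (X n) (Measure.pi fun _ => P) (μ n)) →
      (∀ n l, HasLaw (X' n l) (Measure.pi fun _ => P) (μ n)) →
      (∀ n l, IndepFun (X n) (X' n l) (μ n)) →
      limsup (fun n => μ n {a | (M : ℕ∞) ≤
        minPacking ε fun l => optimizer (ψ n (perturbedInput (J n l) (X n a) (X' n l a)))}) atTop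
        ≤ (δ : ℝ≥0∞)

/-! ### The condition on the density -/

/-- For every `p ≥ 0` there is a finite constant `C` with
`𝔼[|W| ^ p * (1 - f (X + s W) / f X)₊] ≤ C s` for all `s ≥ 0`, where `X` has law `P`, `W` is standard
Gaussian, and `X` and `W` are independent; `f` is meant to be the density of `P`. -/
def SmallRejectionProbability (P : Measure ℝ) (f : ℝ → ℝ) : Prop :=
  ∀ p : ℝ, 0 ≤ p → ∃ C : ℝ, 0 < C ∧ ∀ s : ℝ, 0 ≤ s →
    ∫⁻ z, ENNReal.ofReal (|z.2| ^ p * max (1 - f (z.1 + s * z.2) / f z.1) 0)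
      ∂(P.prod (gaussianReal 0 1)) ≤ ENNReal.ofReal (C * s)

/-! ### The Sherrington–Kirkpatrick model -/

/-- The pairs `(i, j)` of sites with `i < j`, which index the disorder variables. -/
abbrev SKPair (n : ℕ) : Type := {p : Fin n × Fin n // p.1 < p.2}

/-- Spin configurations in `{+1, -1}ⁿ` modulo the global spin flip, represented by those whose first
spin is `+1`. (`ℤˣ` is the two-element set `{1, -1}`.) -/
def SKConfig (n : ℕ) : Type := {σ : Fin n → ℤˣ // ∀ i : Fin n, (i : ℕ) = 0 → σ i = 1}

instance (n : ℕ) : Nonempty (SKConfig n) := ⟨⟨fun _ => 1, fun _ _ => rfl⟩⟩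

/-- The normalized Hamming distance: the fraction of sites at which two configurations differ. -/
noncomputable instance (n : ℕ) : MetricSpace (SKConfig n) where
  dist σ τ := (hammingDist σ.1 τ.1 : ℝ) / n
  dist_self σ := by simp [hammingDist_self]
  dist_comm σ τ := by rw [hammingDist_comm]
  dist_triangle σ τ ρ := by
    rw [← add_div]
    gcongr
    exact_mod_cast hammingDist_triangle σ.1 τ.1 ρ.1
  eq_of_dist_eq_zero {σ τ} h := by
    apply Subtype.ext
    rcases Nat.eq_zero_or_pos n with rfl | hn
    · exact Subsingleton.elim _ _
    · have hn' : (n : ℝ) ≠ 0 := by positivity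
      have h' : (hammingDist σ.1 τ.1 : ℝ) = 0 := by
        rcases div_eq_zero_iff.mp h with h | h
        · exact h
        · exact absurd h hn'
      exact hammingDist_eq_zero.mp (by exact_mod_cast h')

/-- The Hamiltonian `-∑_{i<j} x_{(i,j)} σ_i σ_j`. -/
noncomputable def skHamiltonian (n : ℕ) (x : SKPair n → ℝ) (σ : SKConfig n) : ℝ :=
  -∑ p : SKPair n, x p * ((σ.1 p.1.1 : ℤ) : ℝ) * ((σ.1 p.1.2 : ℤ) : ℝ)

/-!
The key fact is that, with high probability, there are not many well-separated configurations whose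
energies are within `O(1)` of the ground-state energy. Suppose the disorder `X` is replaced by
`X + s W` with an independent standard Gaussian vector `W`, and compare the means of the
ground-state energies.

* The small-rejection condition keeps the change of the mean small. By detailed balance of the
  Metropolis dynamics, the moves `X ↦ X + s W` that would be accepted do not contribute, while each
  variable has a rejected move with probability `O(s)`, which contributes `O(s)`
  (`integral_map_add_mul_le`). Replacing the variables one at a time, the mean changes by at most
  `O(s² n²)` (`integral_pi_le_of_lipschitz`).
* If `M` separated configurations are nearly optimal, the perturbation selects the best of them. The
  energies of separated configurations are weakly correlated under `W`, unless one is nearly the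
  global flip of the other, and Gaussian integration by parts for the Gibbs measure on the `M`
  configurations shows that the gain in mean is at least `s n` times a quantity that tends to
  infinity with `M` (`le_integral_sum_gibbsWeight_mul`, a soft Sudakov minoration).

With `s = 1 / n` the change is bounded and the gain is arbitrarily large, so the probability of `M`
separated nearly optimal configurations is small for large `M`, uniformly in `n`
(`measureReal_manyGroundStates_mul_le`).

Finally, replacing `X_l` by `X'_l` yields a ground state whose energy for the original disorder is
within `2 |X_l - X'_l|` of the optimum, and since the disorder has a first moment, this is bounded
for all but a small fraction of the indices `l` (`mem_manyGroundStates_or_of_le_minPacking`).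
Uniqueness holds because two different configurations have equal energies only on a hyperplane,
which is null as the disorder law has no atoms.
-/

/-! ### Product measures -/

theorem measurable_update_prod {ι α : Type*} [DecidableEq ι] [MeasurableSpace α] (i : ι) :
    Measurable (fun p : (ι → α) × α => Function.update p.1 i p.2) :=
  measurable_pi_lambda _ fun j => by
    rcases eq_or_ne j i with rfl | hj
    · simpa using measurable_snd
    · simp only [Function.update_of_ne hj]
      exact (measurable_pi_apply j).comp measurable_fst

/-- Resampling one coordinate of a product measure gives a product measure. -/
theorem map_update_pi_prod {ι α : Type*} [Fintype ι] [DecidableEq ι] [MeasurableSpace α]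
    (μ μ' : ι → Measure α) [∀ i, IsProbabilityMeasure (μ i)] [∀ i, IsProbabilityMeasure (μ' i)]
    (i : ι) (h : ∀ j, j ≠ i → μ' j = μ j) :
    ((Measure.pi μ).prod (μ' i)).map (fun p : (ι → α) × α => Function.update p.1 i p.2) =
      Measure.pi μ' := by
  refine (Measure.pi_eq fun s hs => ?_).symm
  rw [Measure.map_apply (measurable_update_prod i) (MeasurableSet.univ_pi hs)]
  have : (fun p : (ι → α) × α => Function.update p.1 i p.2) ⁻¹' (Set.univ.pi s) =
      (Set.univ.pi (Function.update s i Set.univ)) ×ˢ s i := by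
    ext p
    simp only [Set.mem_preimage, Set.mem_pi, Set.mem_univ, true_implies, Set.mem_prod]
    constructor
    · intro hp
      refine ⟨fun j => ?_, by simpa using hp i⟩
      rcases eq_or_ne j i with rfl | hj
      · simp
      · simpa [Function.update_of_ne hj] using hp j
    · rintro ⟨h1, h2⟩ j
      rcases eq_or_ne j i with rfl | hj
      · simpa using h2
      · simpa [Function.update_of_ne hj] using h1 j
  rw [this, Measure.prod_prod, Measure.pi_pi, ← Finset.mul_prod_erase _ _ (Finset.mem_univ i),
    ← Finset.mul_prod_erase _ (fun j => μ' j (s j)) (Finset.mem_univ i)]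
  have : ∏ x ∈ Finset.univ.erase i, (μ x) (Function.update s i Set.univ x) =
      ∏ x ∈ Finset.univ.erase i, (μ' x) (s x) := by
    refine Finset.prod_congr rfl fun j hj => ?_
    have hj := Finset.ne_of_mem_erase hj
    rw [Function.update_of_ne hj, h j hj]
  rw [this]
  simp [mul_comm]

theorem integrable_update_prod {ι α : Type*} [Fintype ι] [DecidableEq ι] [MeasurableSpace α]
    {μ μ' : ι → Measure α} [∀ i, IsProbabilityMeasure (μ i)] [∀ i, IsProbabilityMeasure (μ' i)]
    {i : ι} (h : ∀ j, j ≠ i → μ' j = μ j) {φ : (ι → α) → ℝ} (hφ : Integrable φ (Measure.pi μ')) :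
    Integrable (fun p : (ι → α) × α => φ (Function.update p.1 i p.2))
      ((Measure.pi μ).prod (μ' i)) := by
  rw [← map_update_pi_prod μ μ' i h] at hφ
  exact hφ.comp_measurable (measurable_update_prod i)

theorem integral_pi_eq_integral_update {ι α : Type*} [Fintype ι] [DecidableEq ι]
    [MeasurableSpace α] {μ μ' : ι → Measure α} [∀ i, IsProbabilityMeasure (μ i)]
    [∀ i, IsProbabilityMeasure (μ' i)] {i : ι} (h : ∀ j, j ≠ i → μ' j = μ j)
    {φ : (ι → α) → ℝ} (hφ : Integrable φ (Measure.pi μ')) :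
    ∫ x, φ x ∂(Measure.pi μ') = ∫ x, ∫ t, φ (Function.update x i t) ∂(μ' i) ∂(Measure.pi μ) := by
  rw [← integral_prod _ (integrable_update_prod h hφ)]
  rw [← map_update_pi_prod μ μ' i h] at hφ ⊢
  rw [integral_map (measurable_update_prod i).aemeasurable hφ.aestronglyMeasurable]

theorem integrable_pi_of_abs_le_sum {ι : Type*} [Fintype ι] {μ : ι → Measure ℝ}
    [∀ i, IsProbabilityMeasure (μ i)] (hμ : ∀ i, Integrable (fun x => x) (μ i))
    {φ : (ι → ℝ) → ℝ} (hm : Measurable φ) (hφ : ∀ x, |φ x| ≤ ∑ i, |x i|) :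
    Integrable φ (Measure.pi μ) := by
  refine Integrable.mono' (g := fun x => ∑ i, |x i|) ?_ hm.aestronglyMeasurable
    (Eventually.of_forall hφ)
  refine integrable_finsetSum _ fun i _ => ?_
  exact ((measurePreserving_eval μ i).integrable_comp
    (hμ i).abs.aestronglyMeasurable).2 (hμ i).abs

/-- Replacing the factors of a product measure one at a time: if `ν` and `P` are `η`-close when
tested on `1`-Lipschitz functions, then the `ι`-fold products are `card ι * η`-close when tested on
functions that are `1`-Lipschitz in each coordinate. -/
theorem integral_pi_le_of_lipschitz {ι : Type*} [Fintype ι] (P ν : Measure ℝ)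
    [IsProbabilityMeasure P] [IsProbabilityMeasure ν] (hP : Integrable (fun x => x) P)
    (hν : Integrable (fun x => x) ν) {η : ℝ}
    (hη : ∀ g : ℝ → ℝ, (∀ a b, |g a - g b| ≤ |a - b|) → ∫ x, g x ∂ν ≤ ∫ x, g x ∂P + η)
    {φ : (ι → ℝ) → ℝ} (hm : Measurable φ) (hφ : ∀ x, |φ x| ≤ ∑ i, |x i|)
    (hlip : ∀ x y, |φ x - φ y| ≤ ∑ i, |x i - y i|) :
    ∫ x, φ x ∂(Measure.pi fun _ => ν) ≤
      ∫ x, φ x ∂(Measure.pi fun _ => P) + Fintype.card ι * η := by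
  classical
  let ρ : Finset ι → ι → Measure ℝ := fun T i => if i ∈ T then ν else P
  have hρ : ∀ T i, IsProbabilityMeasure (ρ T i) := fun T i => by
    dsimp only [ρ]; split_ifs <;> infer_instance
  have hI : ∀ T i, Integrable (fun x => x) (ρ T i) := fun T i => by
    dsimp only [ρ]; split_ifs <;> assumption
  have hint : ∀ T, Integrable φ (Measure.pi (ρ T)) := fun T =>
    integrable_pi_of_abs_le_sum (hI T) hm hφ
  have key : ∀ T : Finset ι, ∫ x, φ x ∂(Measure.pi (ρ T)) ≤
      ∫ x, φ x ∂(Measure.pi fun _ => P) + T.card * η := by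
    intro T
    induction T using Finset.induction_on with
    | empty => simp [ρ]
    | insert i T hi ih =>
      have h1 : ∀ j, j ≠ i → ρ (insert i T) j = ρ T j := fun j hj => by simp [ρ, hj]
      have e1 : ρ (insert i T) i = ν := by simp [ρ]
      have e2 : ρ T i = P := by simp [ρ, hi]
      have i1 := (integrable_update_prod h1 (hint (insert i T))).integral_prod_left
      have i2 := (integrable_update_prod (fun j _ => rfl) (hint T) (i := i)).integral_prod_left
      have : ∫ x, φ x ∂(Measure.pi (ρ (insert i T))) ≤ ∫ x, φ x ∂(Measure.pi (ρ T)) + η := by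
        rw [integral_pi_eq_integral_update h1 (hint (insert i T)),
          integral_pi_eq_integral_update (fun j _ => rfl) (hint T) (i := i)]
        calc _ ≤ ∫ x, (∫ t, φ (Function.update x i t) ∂(ρ T i) + η) ∂(Measure.pi (ρ T)) := by
              refine integral_mono i1 (i2.add (integrable_const η)) fun x => ?_
              simp only [e1, e2]
              refine hη _ fun a b => (hlip _ _).trans ?_
              rw [Finset.sum_eq_single i]
              · simp
              · intro j _ hj
                simp [hj]
              · simp
          _ = _ := by
              rw [integral_add i2 (integrable_const η)]
              simp
      rw [Finset.card_insert_of_notMem hi]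
      push_cast
      linarith
  simpa [ρ] using key Finset.univ

/-- The law of `X + s W` for independent vectors `X`, `W` with i.i.d. coordinates is a product. -/
theorem map_add_mul_pi_prod_pi {ι : Type*} [Fintype ι] (P γ : Measure ℝ)
    [IsProbabilityMeasure P] [IsProbabilityMeasure γ] (s : ℝ) :
    ((Measure.pi fun _ : ι => P).prod (Measure.pi fun _ : ι => γ)).map
        (fun p i => p.1 i + s * p.2 i) =
      Measure.pi fun _ : ι => (P.prod γ).map fun z => z.1 + s * z.2 := by
  have h0 : Measurable fun z : ℝ × ℝ => z.1 + s * z.2 := by fun_prop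
  have := Measure.isProbabilityMeasure_map (μ := P.prod γ) h0.aemeasurable
  rw [← Measure.pi_map_pi (fun _ => h0.aemeasurable),
    ← (measurePreserving_arrowProdEquivProdArrow ℝ ℝ ι (fun _ => P) (fun _ => γ)).map_eq,
    Measure.map_map (by fun_prop) (MeasurableEquiv.measurable _)]
  rfl

/-! ### Gaussian perturbation of one disorder variable -/

theorem integrable_abs_gaussianReal : Integrable (fun w : ℝ => |w|) (gaussianReal 0 1) :=
  ((memLp_id_gaussianReal (μ := 0) (v := 1) 1).integrable le_rfl).abs

/-- Detailed balance for the Metropolis dynamics with target density `f` and proposal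
`x ↦ x + s w`: increments of an observable have zero mean under the accepted moves. -/
theorem integral_min_density_mul_increment_eq_zero {f : ℝ → ℝ} (hf_meas : Measurable f)
    (hf_nonneg : ∀ x, 0 ≤ f x) (hf_int : Integrable f) {s : ℝ} (hs : 0 ≤ s) {g : ℝ → ℝ}
    (hg : ∀ a b, |g a - g b| ≤ |a - b|) (hgm : Measurable g) :
    ∫ z : ℝ × ℝ, min (f z.1) (f (z.1 + s * z.2)) * (g (z.1 + s * z.2) - g z.1)
      ∂(volume.prod (gaussianReal 0 1)) = 0 := by
  set K : ℝ × ℝ → ℝ := fun z =>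
    min (f z.1) (f (z.1 + s * z.2)) * (g (z.1 + s * z.2) - g z.1) with hK
  have hKi : Integrable K ((volume : Measure ℝ).prod (gaussianReal 0 1)) := by
    refine Integrable.mono' (g := fun z => f z.1 * (s * |z.2|))
      (hf_int.mul_prod (integrable_abs_gaussianReal.const_mul s))
      (by fun_prop) (Eventually.of_forall fun z => ?_)
    rw [hK, Real.norm_eq_abs, abs_mul, abs_of_nonneg (le_min (hf_nonneg _) (hf_nonneg _))]
    refine mul_le_mul (min_le_left _ _) ((hg _ _).trans ?_) (abs_nonneg _) (hf_nonneg _)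
    rw [add_sub_cancel_left, abs_mul, abs_of_nonneg hs]
  rw [integral_prod_symm _ hKi]
  have hodd : ∀ w, ∫ x, K (x, -w) = -∫ x, K (x, w) := fun w => by
    rw [← integral_add_right_eq_self (fun x => K (x, -w)) (s * w), ← integral_neg]
    refine integral_congr_ae (Eventually.of_forall fun x => ?_)
    have : x + s * w + s * -w = x := by ring
    simp only [hK, this, min_comm (f (x + s * w))]
    ring
  have hneg : ∫ w, (∫ x, K (x, w)) ∂(gaussianReal 0 1) =
      ∫ w, (∫ x, K (x, -w)) ∂(gaussianReal 0 1) := by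
    have hmp : MeasurePreserving (MeasurableEquiv.neg ℝ) (gaussianReal 0 1) (gaussianReal 0 1) :=
      ⟨measurable_neg, by simpa using gaussianReal_map_neg (μ := 0) (v := 1)⟩
    exact (hmp.integral_comp' (fun w => ∫ x, K (x, w))).symm
  simp only [hodd, integral_neg] at hneg
  linarith

/-- Under the small-rejection condition, a Gaussian perturbation of size `s` changes the mean of a
`1`-Lipschitz function by `O(s²)` only: accepted Metropolis moves do not contribute, and a
rejected move, of probability `O(s)`, contributes `O(s)`. -/
theorem integral_map_add_mul_le {P : Measure ℝ} [IsProbabilityMeasure P] {f : ℝ → ℝ}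
    (hf_meas : Measurable f) (hf_nonneg : ∀ x, 0 ≤ f x)
    (hf_density : P = volume.withDensity fun x => ENNReal.ofReal (f x))
    (hP : Integrable (fun x : ℝ => x) P) {C s : ℝ} (hC : 0 < C) (hs : 0 ≤ s)
    (hf : ∫⁻ z, ENNReal.ofReal (|z.2| * max (1 - f (z.1 + s * z.2) / f z.1) 0)
      ∂(P.prod (gaussianReal 0 1)) ≤ ENNReal.ofReal (C * s))
    {g : ℝ → ℝ} (hg : ∀ a b, |g a - g b| ≤ |a - b|) :
    ∫ x, g x ∂((P.prod (gaussianReal 0 1)).map fun z => z.1 + s * z.2) ≤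
      ∫ x, g x ∂P + C * s ^ 2 := by
  have hgc : Continuous g := by
    have : LipschitzWith 1 g := LipschitzWith.of_dist_le_mul fun a b => by
      simpa [Real.dist_eq] using hg a b
    exact this.continuous
  have hgm := hgc.measurable
  have hgi : Integrable g P := by
    refine Integrable.mono' (g := fun x => |g 0| + |x|) ((integrable_const _).add hP.abs)
      hgm.aestronglyMeasurable (Eventually.of_forall fun x => ?_)
    have := hg x 0
    rw [sub_zero] at this
    rw [Real.norm_eq_abs]
    calc |g x| = |g 0 + (g x - g 0)| := by ring_nf
      _ ≤ _ := (abs_add_le _ _).trans (by linarith)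
  have hf_int : Integrable f := by
    refine ⟨hf_meas.aestronglyMeasurable, ?_⟩
    rw [hasFiniteIntegral_iff_ofReal (Eventually.of_forall hf_nonneg)]
    have : P Set.univ = 1 := measure_univ
    rw [hf_density, withDensity_apply _ MeasurableSet.univ, Measure.restrict_univ] at this
    simp [this]
  set Q := P.prod (gaussianReal 0 1) with hQ
  set R : ℝ × ℝ → ℝ := fun z => max (1 - f (z.1 + s * z.2) / f z.1) 0 with hR
  have hRm : Measurable R := by fun_prop
  have hR0 : ∀ z, 0 ≤ R z := fun z => le_max_right _ _
  have hR1 : ∀ z, R z ≤ 1 := fun z => max_le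
    (by linarith [div_nonneg (hf_nonneg (z.1 + s * z.2)) (hf_nonneg z.1)]) zero_le_one
  set F : ℝ × ℝ → ℝ := fun z => g (z.1 + s * z.2) - g z.1 with hF
  have hFm : Measurable F := by fun_prop
  have hFb : ∀ z, |F z| ≤ s * |z.2| := fun z => (hg _ _).trans (by
    rw [add_sub_cancel_left, abs_mul, abs_of_nonneg hs])
  have hWi : Integrable (fun z : ℝ × ℝ => |z.2|) Q :=
    integrable_abs_gaussianReal.comp_snd P
  have hFi : Integrable F Q := Integrable.mono' (hWi.const_mul s) hFm.aestronglyMeasurable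
    (Eventually.of_forall hFb)
  have hgi1 : Integrable (fun z : ℝ × ℝ => g z.1) Q := hgi.comp_fst _
  have e1 : ∫ x, g x ∂(Q.map fun z => z.1 + s * z.2) = ∫ x, g x ∂P + ∫ z, F z ∂Q := by
    rw [integral_map (by fun_prop) hgm.aestronglyMeasurable]
    have : ∫ x, g x ∂P = ∫ z, g z.1 ∂Q := by simp [hQ, integral_fun_fst]
    rw [this, ← integral_add hgi1 hFi]
    simp [hF]
  have hFR : Integrable (fun z => F z * R z) Q :=
    hFi.mul_bdd (c := 1) hRm.aestronglyMeasurable (Eventually.of_forall fun z => by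
      rw [Real.norm_eq_abs, abs_of_nonneg (hR0 z)]; exact hR1 z)
  have hWR : Integrable (fun z => |z.2| * R z) Q :=
    hWi.mul_bdd (c := 1) hRm.aestronglyMeasurable (Eventually.of_forall fun z => by
      rw [Real.norm_eq_abs, abs_of_nonneg (hR0 z)]; exact hR1 z)
  have e2 : ∫ z, F z ∂Q = ∫ z, F z * R z ∂Q + ∫ z, F z * (1 - R z) ∂Q := by
    rw [← integral_add hFR]
    · exact integral_congr_ae (Eventually.of_forall fun z => by ring)
    · exact (hFi.sub hFR).congr (Eventually.of_forall fun z => by simp; ring)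
  have e3 : ∫ z, F z * (1 - R z) ∂Q = 0 := by
    rw [← integral_min_density_mul_increment_eq_zero hf_meas hf_nonneg hf_int hs hg hgm, hQ,
      hf_density, prod_withDensity_left (by fun_prop),
      integral_withDensity_eq_integral_toReal_smul (by fun_prop)
        (Eventually.of_forall fun _ => ENNReal.ofReal_lt_top)]
    refine integral_congr_ae (Eventually.of_forall fun z => ?_)
    have : f z.1 * (1 - R z) = min (f z.1) (f (z.1 + s * z.2)) := by
      simp only [hR]
      rcases (hf_nonneg z.1).eq_or_lt with h | h
      · rw [← h, zero_mul, min_eq_left (hf_nonneg _)]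
      · rcases le_total (f z.1) (f (z.1 + s * z.2)) with h' | h'
        · rw [min_eq_left h', max_eq_right (by linarith [(one_le_div h).2 h'])]
          ring
        · rw [min_eq_right h', max_eq_left (by linarith [(div_le_one h).2 h'])]
          field_simp
          ring
    simp only [ENNReal.toReal_ofReal (hf_nonneg _), smul_eq_mul, ← this, hF]
    ring
  have e4 : ∫ z, F z * R z ∂Q ≤ s * ∫ z, |z.2| * R z ∂Q := by
    rw [← integral_const_mul]
    refine integral_mono hFR (hWR.const_mul s) fun z => ?_
    have := mul_le_mul_of_nonneg_right ((le_abs_self _).trans (hFb z)) (hR0 z)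
    simp only
    linarith
  have e5 : ∫ z, |z.2| * R z ∂Q ≤ C * s := by
    rw [integral_eq_lintegral_of_nonneg_ae
      (Eventually.of_forall fun z => mul_nonneg (abs_nonneg _) (hR0 z)) hWR.aestronglyMeasurable]
    exact ENNReal.toReal_le_of_le_ofReal (by positivity) hf
  rw [e1, e2, e3]
  nlinarith [mul_le_mul_of_nonneg_left e5 hs]

/-! ### Gaussian integration by parts -/

theorem integrable_gaussianReal_iff {h : ℝ → ℝ} :
    Integrable h (gaussianReal 0 1) ↔ Integrable (fun t => gaussianPDFReal 0 1 t * h t) := by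
  rw [gaussianReal_of_var_ne_zero 0 one_ne_zero,
    integrable_withDensity_iff_integrable_smul' (measurable_gaussianPDF 0 1)
      (Eventually.of_forall fun _ => gaussianPDF_lt_top)]
  simp [toReal_gaussianPDF]

/-- Stein's identity for the standard Gaussian. -/
theorem integral_mul_gaussianReal_eq_integral_deriv {h h' : ℝ → ℝ}
    (hd : ∀ t, HasDerivAt h (h' t) t) (hh : Integrable h (gaussianReal 0 1))
    (hth : Integrable (fun t => t * h t) (gaussianReal 0 1))
    (hh' : Integrable h' (gaussianReal 0 1)) :
    ∫ t, t * h t ∂(gaussianReal 0 1) = ∫ t, h' t ∂(gaussianReal 0 1) := by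
  have hpdf : ∀ t, HasDerivAt (gaussianPDFReal 0 1) (-(t * gaussianPDFReal 0 1 t)) t := fun t => by
    have h1 : HasDerivAt (fun t : ℝ => -(t - 0) ^ 2 / (2 * (1 : ℝ≥0))) (-t) t := by
      have := (((hasDerivAt_id t).sub_const 0).pow 2).neg.div_const (2 * ((1 : ℝ≥0) : ℝ))
      refine this.congr_deriv ?_
      simp
      ring
    have := h1.exp.const_mul (√(2 * Real.pi * (1 : ℝ≥0)))⁻¹
    refine this.congr_deriv ?_
    simp only [gaussianPDFReal]
    ring
  rw [integrable_gaussianReal_iff] at hh hth hh'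
  rw [integral_gaussianReal_eq_integral_smul one_ne_zero,
    integral_gaussianReal_eq_integral_smul one_ne_zero]
  have := integral_mul_deriv_eq_deriv_mul_of_integrable (u := h) (u' := h')
    (v := gaussianPDFReal 0 1) (v' := fun t => -(t * gaussianPDFReal 0 1 t))
    (fun t _ => hd t) (fun t _ => hpdf t)
    (hth.neg.congr (Eventually.of_forall fun t => by simp; ring))
    (hh'.congr (Eventually.of_forall fun t => by simp; ring))
    (hh.congr (Eventually.of_forall fun t => by simp; ring))
  simp only [smul_eq_mul]
  calc _ = -∫ t, h t * -(t * gaussianPDFReal 0 1 t) := by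
        rw [← integral_neg]
        exact integral_congr_ae (Eventually.of_forall fun t => by simp only; ring)
    _ = _ := by
        rw [this, neg_neg]
        exact integral_congr_ae (Eventually.of_forall fun t => by simp only; ring)

theorem integrable_of_abs_le {α : Type*} [MeasurableSpace α] {μ : Measure α} [IsFiniteMeasure μ]
    {h : α → ℝ} (hm : Measurable h) (B : ℝ) (hB : ∀ x, |h x| ≤ B) : Integrable h μ :=
  Integrable.mono' (integrable_const B) hm.aestronglyMeasurable (Eventually.of_forall hB)

theorem integrable_eval_gaussian {ι : Type*} [Fintype ι] (e : ι) :
    Integrable (fun w : ι → ℝ => w e) (Measure.pi fun _ : ι => gaussianReal 0 1) :=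
  (measurePreserving_eval (fun _ : ι => gaussianReal 0 1) e).integrable_comp_of_integrable
    ((memLp_id_gaussianReal (μ := 0) (v := 1) 1).integrable le_rfl)

theorem integrable_eval_mul_of_abs_le {ι : Type*} [Fintype ι] (e : ι) {h : (ι → ℝ) → ℝ}
    (hm : Measurable h) (B : ℝ) (hB : ∀ x, |h x| ≤ B) :
    Integrable (fun x => x e * h x) (Measure.pi fun _ : ι => gaussianReal 0 1) :=
  (integrable_eval_gaussian e).mul_bdd (c := B) hm.aestronglyMeasurable
    (Eventually.of_forall hB)

theorem integral_eval_mul_eq_integral_deriv {ι : Type*} [Fintype ι] [DecidableEq ι] (e : ι)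
    {h h' : (ι → ℝ) → ℝ} (hm : Measurable h) (hm' : Measurable h') (B : ℝ) (hB : ∀ x, |h x| ≤ B)
    (hB' : ∀ x, |h' x| ≤ B)
    (hd : ∀ x t, HasDerivAt (fun t => h (Function.update x e t)) (h' (Function.update x e t)) t) :
    ∫ x, x e * h x ∂(Measure.pi fun _ : ι => gaussianReal 0 1) =
      ∫ x, h' x ∂(Measure.pi fun _ : ι => gaussianReal 0 1) := by
  rw [integral_pi_eq_integral_update (fun j _ => rfl) (integrable_eval_mul_of_abs_le e hm B hB)
      (i := e), integral_pi_eq_integral_update (fun j _ => rfl) (integrable_of_abs_le hm' B hB')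
      (i := e)]
  congr 1
  funext x
  have hu : Measurable fun t => Function.update x e t := measurable_update x
  have hi : Integrable (fun t => h (Function.update x e t)) (gaussianReal 0 1) :=
    integrable_of_abs_le (hm.comp hu) B fun t => hB _
  have := integral_mul_gaussianReal_eq_integral_deriv (hd x) hi
    (((memLp_id_gaussianReal (μ := 0) (v := 1) 1).integrable le_rfl).mul_bdd (c := B)
      (hm.comp hu).aestronglyMeasurable (Eventually.of_forall fun t => hB _))
    (integrable_of_abs_le (hm'.comp hu) B fun t => hB' _)
  simpa using this

theorem integral_exp_sum_mul_pi_gaussianReal {ι : Type*} [Fintype ι] (c : ι → ℝ) :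
    ∫ x, Real.exp (∑ e, c e * x e) ∂(Measure.pi fun _ : ι => gaussianReal 0 1) =
      Real.exp (∑ e, c e ^ 2 / 2) := by
  simp only [Real.exp_sum]
  rw [integral_fintype_prod_eq_prod (fun e t => Real.exp (c e * t))]
  refine Finset.prod_congr rfl fun e _ => ?_
  have := congrFun (mgf_fun_id_gaussianReal (μ := 0) (v := 1)) (c e)
  simpa [mgf] using this

theorem integrable_exp_sum_mul_pi_gaussianReal {ι : Type*} [Fintype ι] (c : ι → ℝ) :
    Integrable (fun x => Real.exp (∑ e, c e * x e))
      (Measure.pi fun _ : ι => gaussianReal 0 1) := by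
  simp only [Real.exp_sum]
  exact Integrable.fintype_prod (f := fun e t => Real.exp (c e * t))
    fun e => integrable_exp_mul_gaussianReal (c e)

/-! ### Gibbs weights and a soft Sudakov minoration -/

/-- The Gibbs weight of `a` among the elements of `T`, at inverse temperature `lam`, when the
Hamiltonian is minus the linear form with coefficients `v a`. -/
noncomputable def gibbsWeight {ι S : Type*} [Fintype ι] (T : Finset S) (v : S → ι → ℝ) (lam : ℝ)
    (a : S) (w : ι → ℝ) : ℝ :=
  Real.exp (lam * ∑ e, w e * v a e) / ∑ b ∈ T, Real.exp (lam * ∑ e, w e * v b e)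

section
variable {ι S : Type*} [Fintype ι] {T : Finset S} {v : S → ι → ℝ} {lam : ℝ}

theorem gibbs_partition_pos (hT : T.Nonempty) (w : ι → ℝ) :
    0 < ∑ b ∈ T, Real.exp (lam * ∑ e, w e * v b e) :=
  Finset.sum_pos (fun _ _ => Real.exp_pos _) hT

theorem gibbsWeight_nonneg (a : S) (w : ι → ℝ) : 0 ≤ gibbsWeight T v lam a w :=
  div_nonneg (Real.exp_pos _).le (Finset.sum_nonneg fun _ _ => (Real.exp_pos _).le)

theorem sum_gibbsWeight (hT : T.Nonempty) (w : ι → ℝ) :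
    ∑ a ∈ T, gibbsWeight T v lam a w = 1 := by
  simp only [gibbsWeight, ← Finset.sum_div]
  exact div_self (gibbs_partition_pos hT w).ne'

theorem gibbsWeight_le_one {a : S} (ha : a ∈ T) (w : ι → ℝ) : gibbsWeight T v lam a w ≤ 1 := by
  rw [← sum_gibbsWeight ⟨a, ha⟩ w]
  exact Finset.single_le_sum (f := fun a => gibbsWeight T v lam a w)
    (fun b _ => gibbsWeight_nonneg b w) ha

theorem measurable_gibbsWeight (a : S) : Measurable (gibbsWeight T v lam a) := by
  unfold gibbsWeight
  fun_prop

theorem hasDerivAt_gibbsWeight [DecidableEq ι] (hT : T.Nonempty) (a : S) (x : ι → ℝ) (e : ι)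
    (t : ℝ) :
    HasDerivAt (fun t => gibbsWeight T v lam a (Function.update x e t))
      (lam * (gibbsWeight T v lam a (Function.update x e t) *
        (v a e - ∑ b ∈ T, gibbsWeight T v lam b (Function.update x e t) * v b e))) t := by
  have hlin : ∀ b, HasDerivAt
      (fun t => Real.exp (lam * ∑ i, Function.update x e t i * v b i))
      (Real.exp (lam * ∑ i, Function.update x e t i * v b i) * (lam * v b e)) t := fun b => by
    have h1 : HasDerivAt (fun t => ∑ i, Function.update x e t i * v b i) (v b e) t := by
      have : (fun t => ∑ i, Function.update x e t i * v b i) =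
          fun t => t * v b e + ∑ i ∈ Finset.univ.erase e, x i * v b i := by
        funext t
        rw [← Finset.add_sum_erase _ _ (Finset.mem_univ e), Function.update_self]
        congr 1
        exact Finset.sum_congr rfl fun i hi => by
          rw [Function.update_of_ne (Finset.ne_of_mem_erase hi)]
      rw [this]
      simpa using ((hasDerivAt_id t).mul_const (v b e)).add_const
        (∑ i ∈ Finset.univ.erase e, x i * v b i)
    exact (h1.const_mul lam).exp
  have hsum := HasDerivAt.fun_sum (u := T) fun b _ => hlin b
  have hZ := (gibbs_partition_pos (v := v) (lam := lam) hT (Function.update x e t)).ne'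
  refine ((hlin a).div hsum hZ).congr_deriv ?_
  simp only [gibbsWeight]
  set Z := ∑ b ∈ T, Real.exp (lam * ∑ i, Function.update x e t i * v b i) with hZdef
  have h2 : ∑ b ∈ T, Real.exp (lam * ∑ i, Function.update x e t i * v b i) / Z * v b e =
      (∑ b ∈ T, Real.exp (lam * ∑ i, Function.update x e t i * v b i) * v b e) / Z := by
    rw [Finset.sum_div]
    exact Finset.sum_congr rfl fun b _ => by ring
  have h3 : ∑ b ∈ T, Real.exp (lam * ∑ i, Function.update x e t i * v b i) * (lam * v b e) =
      lam * ∑ b ∈ T, Real.exp (lam * ∑ i, Function.update x e t i * v b i) * v b e := by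
    rw [Finset.mul_sum]
    exact Finset.sum_congr rfl fun b _ => by ring
  rw [h2, h3]
  field_simp

/-- Gaussian integration by parts for the Gibbs average of the energy. -/
theorem integral_sum_gibbsWeight_mul (hT : T.Nonempty) (hv : ∀ a e, v a e ^ 2 = 1) :
    ∫ w, ∑ a ∈ T, gibbsWeight T v lam a w * ∑ e, w e * v a e
        ∂(Measure.pi fun _ : ι => gaussianReal 0 1) =
      ∫ w, lam * ∑ a ∈ T, ∑ b ∈ T, gibbsWeight T v lam a w * gibbsWeight T v lam b w *
        ∑ e, (1 - v a e * v b e) ∂(Measure.pi fun _ : ι => gaussianReal 0 1) := by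
  classical
  have hv1 : ∀ a e, |v a e| ≤ 1 := fun a e => by
    rw [← sq_le_one_iff_abs_le_one, hv]
  have hpa : ∀ a ∈ T, ∀ w, |gibbsWeight T v lam a w| ≤ 1 := fun a ha w => by
    rw [abs_of_nonneg (gibbsWeight_nonneg a w)]
    exact gibbsWeight_le_one ha w
  have havg : ∀ e w, |∑ b ∈ T, gibbsWeight T v lam b w * v b e| ≤ 1 := fun e w => by
    refine (Finset.abs_sum_le_sum_abs _ _).trans ?_
    rw [← sum_gibbsWeight (v := v) (lam := lam) hT w]
    refine Finset.sum_le_sum fun b _ => ?_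
    rw [abs_mul, abs_of_nonneg (gibbsWeight_nonneg b w)]
    exact mul_le_of_le_one_right (gibbsWeight_nonneg b w) (hv1 b e)
  let D : S → ι → (ι → ℝ) → ℝ := fun a e w =>
    lam * (gibbsWeight T v lam a w * (v a e - ∑ b ∈ T, gibbsWeight T v lam b w * v b e))
  have hpm := fun a => measurable_gibbsWeight (T := T) (v := v) (lam := lam) a
  have hDm : ∀ a e, Measurable (D a e) := fun a e => by
    dsimp only [D]
    fun_prop
  have hDb : ∀ a ∈ T, ∀ e w, |D a e w| ≤ |lam| * 2 := fun a ha e w => by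
    dsimp only [D]
    rw [abs_mul, abs_mul]
    refine mul_le_mul_of_nonneg_left ?_ (abs_nonneg _)
    have h1 := hpa a ha w
    have h2 := (abs_sub _ _).trans (add_le_add (hv1 a e) (havg e w))
    nlinarith [abs_nonneg (gibbsWeight T v lam a w),
      abs_nonneg (v a e - ∑ b ∈ T, gibbsWeight T v lam b w * v b e)]
  have hibp : ∀ a ∈ T, ∀ e,
      ∫ w, w e * gibbsWeight T v lam a w ∂(Measure.pi fun _ : ι => gaussianReal 0 1) =
        ∫ w, D a e w ∂(Measure.pi fun _ : ι => gaussianReal 0 1) := fun a ha e =>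
    integral_eval_mul_eq_integral_deriv e (hpm a) (hDm a e) (1 + |lam| * 2)
      (fun w => (hpa a ha w).trans (by linarith [abs_nonneg lam]))
      (fun w => (hDb a ha e w).trans (by linarith))
      (fun x t => hasDerivAt_gibbsWeight hT a x e t)
  have hi1 : ∀ a ∈ T, ∀ e, Integrable (fun w => v a e * (w e * gibbsWeight T v lam a w))
      (Measure.pi fun _ : ι => gaussianReal 0 1) := fun a ha e =>
    (integrable_eval_mul_of_abs_le e (hpm a) 1 (hpa a ha)).const_mul _
  have hi2 : ∀ a ∈ T, ∀ e, Integrable (fun w => v a e * D a e w)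
      (Measure.pi fun _ : ι => gaussianReal 0 1) := fun a ha e =>
    (integrable_of_abs_le (hDm a e) _ (hDb a ha e)).const_mul _
  calc _ = ∫ w, ∑ a ∈ T, ∑ e, v a e * (w e * gibbsWeight T v lam a w)
        ∂(Measure.pi fun _ : ι => gaussianReal 0 1) := by
        refine integral_congr_ae (Eventually.of_forall fun w => ?_)
        simp only [Finset.mul_sum]
        exact Finset.sum_congr rfl fun a _ => Finset.sum_congr rfl fun e _ => by ring
    _ = ∫ w, ∑ a ∈ T, ∑ e, v a e * D a e w ∂(Measure.pi fun _ : ι => gaussianReal 0 1) := by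
        rw [integral_finsetSum _ fun a ha => integrable_finsetSum _ fun e _ => hi1 a ha e,
          integral_finsetSum _ fun a ha => integrable_finsetSum _ fun e _ => hi2 a ha e]
        refine Finset.sum_congr rfl fun a ha => ?_
        rw [integral_finsetSum _ fun e _ => hi1 a ha e,
          integral_finsetSum _ fun e _ => hi2 a ha e]
        refine Finset.sum_congr rfl fun e _ => ?_
        rw [integral_const_mul, integral_const_mul, hibp a ha e]
    _ = _ := by
        refine integral_congr_ae (Eventually.of_forall fun w => ?_)
        simp only [D]
        rw [Finset.mul_sum]
        refine Finset.sum_congr rfl fun a _ => ?_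
        have h1 : ∀ e, v a e * (lam * (gibbsWeight T v lam a w *
            (v a e - ∑ b ∈ T, gibbsWeight T v lam b w * v b e))) =
            lam * ∑ b ∈ T, gibbsWeight T v lam a w * gibbsWeight T v lam b w *
              (1 - v a e * v b e) := fun e => by
          have h2 : ∑ b ∈ T, gibbsWeight T v lam a w * gibbsWeight T v lam b w *
              (1 - v a e * v b e) = gibbsWeight T v lam a w *
                (∑ b ∈ T, gibbsWeight T v lam b w -
                  v a e * ∑ b ∈ T, gibbsWeight T v lam b w * v b e) := by
            rw [Finset.mul_sum, ← Finset.sum_sub_distrib, Finset.mul_sum]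
            exact Finset.sum_congr rfl fun b _ => by ring
          rw [h2, sum_gibbsWeight hT]
          linear_combination lam * gibbsWeight T v lam a w * hv a e
        simp only [h1, Finset.mul_sum]
        exact Finset.sum_comm

/-- The Gibbs measure on many configurations is spread out: its expected collision probability
is at most inversely proportional to their number, with a constant exponential in `lam ^ 2`. -/
theorem integral_sum_gibbsWeight_sq_le (hT : T.Nonempty) (hv : ∀ a e, v a e ^ 2 = 1) :
    ∫ w, ∑ a ∈ T, gibbsWeight T v lam a w ^ 2 ∂(Measure.pi fun _ : ι => gaussianReal 0 1) ≤
      Real.exp (8 * lam ^ 2 * Fintype.card ι) / T.card := by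
  have hm : (0 : ℝ) < T.card := by exact_mod_cast hT.card_pos
  have hv1 : ∀ a e, |v a e| ≤ 1 := fun a e => by
    rw [← sq_le_one_iff_abs_le_one, hv]
  let c : S → S → ι → ℝ := fun a b e => 2 * lam * (v a e - v b e)
  have hpt : ∀ w, ∑ a ∈ T, gibbsWeight T v lam a w ^ 2 ≤
      ((T.card : ℝ) ^ 3)⁻¹ * ∑ a ∈ T, ∑ b ∈ T, Real.exp (∑ e, c a b e * w e) := fun w => by
    let y : S → ℝ := fun a => Real.exp (lam * ∑ e, w e * v a e)
    have hy : ∀ a, 0 < y a := fun a => Real.exp_pos _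
    have hZ : 0 < ∑ b ∈ T, y b := gibbs_partition_pos hT w
    -- Cauchy-Schwarz twice: `m² ≤ (∑ y) (∑ 1/y)` and `(∑ 1/y)² ≤ m ∑ 1/y²`
    have h1 : (T.card : ℝ) ^ 2 ≤ (∑ b ∈ T, y b) * ∑ b ∈ T, (y b)⁻¹ := by
      have := Finset.sum_sq_le_sum_mul_sum_of_sq_le_mul T (r := fun _ => (1 : ℝ))
        (fun b _ => (hy b).le) (fun b _ => (inv_pos.2 (hy b)).le)
        (fun b _ => by rw [mul_inv_cancel₀ (hy b).ne']; norm_num)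
      simpa using this
    have h2 : (∑ b ∈ T, (y b)⁻¹) ^ 2 ≤ T.card * ∑ b ∈ T, ((y b)⁻¹) ^ 2 :=
      sq_sum_le_card_mul_sum_sq
    have h3 : ((∑ b ∈ T, y b) ^ 2)⁻¹ ≤ ((T.card : ℝ) ^ 3)⁻¹ * ∑ b ∈ T, ((y b)⁻¹) ^ 2 := by
      rw [inv_mul_eq_div, le_div_iff₀ (by positivity), inv_mul_le_iff₀ (by positivity)]
      have h4 : (T.card : ℝ) ^ 4 ≤ (∑ b ∈ T, y b) ^ 2 * (T.card * ∑ b ∈ T, ((y b)⁻¹) ^ 2) :=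
        calc (T.card : ℝ) ^ 4 = ((T.card : ℝ) ^ 2) ^ 2 := by ring
          _ ≤ ((∑ b ∈ T, y b) * ∑ b ∈ T, (y b)⁻¹) ^ 2 := by gcongr
          _ = (∑ b ∈ T, y b) ^ 2 * (∑ b ∈ T, (y b)⁻¹) ^ 2 := by ring
          _ ≤ _ := by gcongr
      refine le_of_mul_le_mul_left ?_ hm
      linarith
    have h5 : ∀ a b, Real.exp (∑ e, c a b e * w e) = y a ^ 2 * ((y b)⁻¹) ^ 2 := fun a b => by
      simp only [y, c, ← Real.exp_neg, ← Real.exp_nat_mul, ← Real.exp_add]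
      congr 1
      simp only [Finset.mul_sum, ← Finset.sum_neg_distrib, ← Finset.sum_add_distrib]
      exact Finset.sum_congr rfl fun e _ => by push_cast; ring
    simp only [h5, ← Finset.mul_sum, ← Finset.sum_mul]
    have h6 : ∑ a ∈ T, gibbsWeight T v lam a w ^ 2 =
        (∑ a ∈ T, y a ^ 2) * ((∑ b ∈ T, y b) ^ 2)⁻¹ := by
      simp only [gibbsWeight, div_pow, ← Finset.sum_div, ← div_eq_mul_inv, y]
    rw [h6]
    have := mul_le_mul_of_nonneg_left h3 (Finset.sum_nonneg fun a _ => sq_nonneg (y a) :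
      (0 : ℝ) ≤ ∑ a ∈ T, y a ^ 2)
    linarith
  have hi : ∀ a b, Integrable (fun w => Real.exp (∑ e, c a b e * w e))
      (Measure.pi fun _ : ι => gaussianReal 0 1) :=
    fun a b => integrable_exp_sum_mul_pi_gaussianReal _
  have hmom : ∀ a b, ∫ w, Real.exp (∑ e, c a b e * w e)
      ∂(Measure.pi fun _ : ι => gaussianReal 0 1) ≤
        Real.exp (8 * lam ^ 2 * Fintype.card ι) := fun a b => by
    rw [integral_exp_sum_mul_pi_gaussianReal, Real.exp_le_exp]
    calc ∑ e, c a b e ^ 2 / 2 ≤ ∑ _e : ι, 8 * lam ^ 2 := by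
          refine Finset.sum_le_sum fun e _ => ?_
          have h1 := abs_le.1 (hv1 a e)
          have h2 := abs_le.1 (hv1 b e)
          have h3 : (v a e - v b e) ^ 2 ≤ 4 := by nlinarith
          simp only [c]
          nlinarith [mul_le_mul_of_nonneg_left h3 (sq_nonneg lam)]
      _ = _ := by simp; ring
  calc _ ≤ ∫ w, ((T.card : ℝ) ^ 3)⁻¹ * ∑ a ∈ T, ∑ b ∈ T, Real.exp (∑ e, c a b e * w e)
        ∂(Measure.pi fun _ : ι => gaussianReal 0 1) := by
        refine integral_mono_of_nonneg (Eventually.of_forall fun w =>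
          Finset.sum_nonneg fun a _ => sq_nonneg _) ?_ (Eventually.of_forall hpt)
        exact (integrable_finsetSum _ fun a _ => integrable_finsetSum _ fun b _ =>
          hi a b).const_mul _
    _ = ((T.card : ℝ) ^ 3)⁻¹ * ∑ a ∈ T, ∑ b ∈ T, ∫ w, Real.exp (∑ e, c a b e * w e)
        ∂(Measure.pi fun _ : ι => gaussianReal 0 1) := by
        rw [integral_const_mul, integral_finsetSum _ fun a _ =>
          integrable_finsetSum _ fun b _ => hi a b]
        congr 1
        exact Finset.sum_congr rfl fun a _ => integral_finsetSum _ fun b _ => hi a b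
    _ ≤ ((T.card : ℝ) ^ 3)⁻¹ * ∑ a ∈ T, ∑ b ∈ T, Real.exp (8 * lam ^ 2 * Fintype.card ι) := by
        gcongr with a _ b _
        exact hmom a b
    _ = _ := by
        simp only [Finset.sum_const, nsmul_eq_mul]
        field_simp

/-- A soft form of Sudakov's minoration. If each of the `m` sign vectors `v a` has at most one
other that is close to it, then the Gibbs average of the Gaussian process `∑ e, w e * v a e`, which
is a lower bound of its maximum, is large in expectation as soon as `m` is exponentially large. -/
theorem le_integral_sum_gibbsWeight_mul (hv : ∀ a e, v a e ^ 2 = 1) (hlam : 0 ≤ lam)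
    {r : ℝ} (hr : 0 ≤ r)
    (hclose : ∀ a ∈ T, (T.filter fun b => ∑ e, (1 - v a e * v b e) < r).card ≤ 2)
    (hcard : 4 * Real.exp (8 * lam ^ 2 * Fintype.card ι) ≤ T.card) :
    lam * r / 2 ≤ ∫ w, ∑ a ∈ T, gibbsWeight T v lam a w * ∑ e, w e * v a e
        ∂(Measure.pi fun _ : ι => gaussianReal 0 1) := by
  have hm : (0 : ℝ) < T.card := lt_of_lt_of_le (by positivity) hcard
  have hT : T.Nonempty := Finset.card_pos.1 (by exact_mod_cast hm)
  have hpa : ∀ a ∈ T, ∀ w, |gibbsWeight T v lam a w| ≤ 1 := fun a ha w => by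
    rw [abs_of_nonneg (gibbsWeight_nonneg a w)]
    exact gibbsWeight_le_one ha w
  have hpm := fun a => measurable_gibbsWeight (T := T) (v := v) (lam := lam) a
  have hD0 : ∀ a b, 0 ≤ ∑ e, (1 - v a e * v b e) := fun a b =>
    Finset.sum_nonneg fun e _ => by nlinarith [hv a e, hv b e, sq_nonneg (v a e - v b e)]
  have hpt : ∀ w, r - 2 * r * ∑ a ∈ T, gibbsWeight T v lam a w ^ 2 ≤
      ∑ a ∈ T, ∑ b ∈ T, gibbsWeight T v lam a w * gibbsWeight T v lam b w *
        ∑ e, (1 - v a e * v b e) := fun w => by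
    let p : S → ℝ := fun a => gibbsWeight T v lam a w
    have hp : ∀ a, 0 ≤ p a := fun a => gibbsWeight_nonneg a w
    have hp1 : ∑ a ∈ T, p a = 1 := sum_gibbsWeight hT w
    let χ : S → S → ℝ := fun a b => if ∑ e, (1 - v a e * v b e) < r then 1 else 0
    have hχs : ∀ a b, χ a b = χ b a := fun a b => by simp only [χ, mul_comm]
    have hχc : ∀ a ∈ T, ∑ b ∈ T, χ a b ≤ 2 := fun a ha => by
      simp only [χ, Finset.sum_boole]
      exact_mod_cast hclose a ha
    have hχ0 : ∀ a b, 0 ≤ χ a b := fun a b => by simp only [χ]; split_ifs <;> norm_num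
    have h1 : ∑ a ∈ T, ∑ b ∈ T, (p a * p b * r - r * (p a ^ 2 * χ a b + p b ^ 2 * χ b a) / 2) ≤
        ∑ a ∈ T, ∑ b ∈ T, p a * p b * ∑ e, (1 - v a e * v b e) := by
      refine Finset.sum_le_sum fun a _ => Finset.sum_le_sum fun b _ => ?_
      rw [hχs b a]
      have hpp := mul_nonneg (hp a) (hp b)
      by_cases hab : ∑ e, (1 - v a e * v b e) < r
      · simp only [χ, if_pos hab]
        nlinarith [mul_nonneg hr (sq_nonneg (p a - p b)), mul_nonneg hpp (hD0 a b)]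
      · simp only [χ, if_neg hab]
        nlinarith [mul_le_mul_of_nonneg_left (not_lt.1 hab) hpp]
    have h2 : ∑ a ∈ T, ∑ b ∈ T, p a ^ 2 * χ a b ≤ 2 * ∑ a ∈ T, p a ^ 2 := by
      rw [Finset.mul_sum]
      refine Finset.sum_le_sum fun a ha => ?_
      rw [← Finset.mul_sum]
      nlinarith [hχc a ha, sq_nonneg (p a)]
    have h3 : ∑ a ∈ T, ∑ b ∈ T, p b ^ 2 * χ b a = ∑ a ∈ T, ∑ b ∈ T, p a ^ 2 * χ a b :=
      Finset.sum_comm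
    have h4 : ∑ a ∈ T, ∑ b ∈ T,
        (p a * p b * r - r * (p a ^ 2 * χ a b + p b ^ 2 * χ b a) / 2) =
        r - r * ∑ a ∈ T, ∑ b ∈ T, p a ^ 2 * χ a b := by
      have h5 : ∑ a ∈ T, ∑ b ∈ T, p a * p b * r = r := by
        simp only [← Finset.sum_mul, ← Finset.mul_sum, hp1]
        simp
      have h6 : ∑ a ∈ T, ∑ b ∈ T, r * (p a ^ 2 * χ a b + p b ^ 2 * χ b a) / 2 =
          r * ∑ a ∈ T, ∑ b ∈ T, p a ^ 2 * χ a b := by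
        simp only [← Finset.sum_div, ← Finset.mul_sum, Finset.sum_add_distrib, h3]
        ring
      simp only [Finset.sum_sub_distrib, h5, h6]
    rw [h4] at h1
    nlinarith [mul_le_mul_of_nonneg_left h2 hr]
  rw [integral_sum_gibbsWeight_mul hT hv, integral_const_mul]
  have hi1 : Integrable (fun w => ∑ a ∈ T, gibbsWeight T v lam a w ^ 2)
      (Measure.pi fun _ : ι => gaussianReal 0 1) :=
    integrable_finsetSum _ fun a ha => integrable_of_abs_le (by fun_prop) 1 fun w => by
      rw [abs_pow]
      exact pow_le_one₀ (abs_nonneg _) (hpa a ha w)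
  have hi2 : Integrable (fun w => ∑ a ∈ T, ∑ b ∈ T, gibbsWeight T v lam a w *
      gibbsWeight T v lam b w * ∑ e, (1 - v a e * v b e))
      (Measure.pi fun _ : ι => gaussianReal 0 1) :=
    integrable_finsetSum _ fun a ha => integrable_finsetSum _ fun b hb =>
      (integrable_of_abs_le (by fun_prop) 1 fun w => by
        rw [abs_mul]
        exact mul_le_one₀ (hpa a ha w) (abs_nonneg _) (hpa b hb w)).mul_const _
  have h1 : ∫ w, (r - 2 * r * ∑ a ∈ T, gibbsWeight T v lam a w ^ 2)
      ∂(Measure.pi fun _ : ι => gaussianReal 0 1) ≤ _ :=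
    integral_mono ((integrable_const r).sub (hi1.const_mul (2 * r))) hi2 hpt
  rw [integral_sub (integrable_const r) (hi1.const_mul (2 * r)), integral_const_mul] at h1
  simp only [integral_const, probReal_univ, smul_eq_mul, one_mul] at h1
  have h2 := integral_sum_gibbsWeight_sq_le (lam := lam) hT hv
  have h3 : Real.exp (8 * lam ^ 2 * Fintype.card ι) / T.card ≤ 1 / 4 := by
    rw [div_le_iff₀ hm]
    linarith
  have h4 := mul_le_mul_of_nonneg_left (h2.trans h3) hr
  have h5 := mul_le_mul_of_nonneg_left (le_trans (b := r - 2 * (r * (1 / 4))) (by linarith)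
    (le_trans (by linarith) h1) : r / 2 ≤ _) hlam
  linarith

end

/-! ### Near-maximizers of random linear forms -/

/-- The maximum over `a` of the linear forms `x ↦ ∑ e, x e * v a e`; up to sign this is the
ground-state energy of the disorder `x`. -/
noncomputable def maxValue {ι S : Type*} [Fintype ι] (v : S → ι → ℝ) (x : ι → ℝ) : ℝ :=
  ⨆ a, ∑ e, x e * v a e

section
variable {ι S : Type*} [Fintype ι] [Finite S] {v : S → ι → ℝ}

theorem le_maxValue (x : ι → ℝ) (a : S) : ∑ e, x e * v a e ≤ maxValue v x :=
  le_ciSup (f := fun a => ∑ e, x e * v a e) (Set.finite_range _).bddAbove a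

theorem exists_eq_maxValue [Nonempty S] (v : S → ι → ℝ) (x : ι → ℝ) :
    ∃ a, ∑ e, x e * v a e = maxValue v x :=
  exists_eq_ciSup_of_finite (f := fun a => ∑ e, x e * v a e)

theorem abs_maxValue_sub_le [Nonempty S] (hv : ∀ a e, v a e ^ 2 = 1) (x y : ι → ℝ) :
    |maxValue v x - maxValue v y| ≤ ∑ e, |x e - y e| := by
  have key : ∀ x y : ι → ℝ, maxValue v x - maxValue v y ≤ ∑ e, |x e - y e| := fun x y => by
    obtain ⟨a, ha⟩ := exists_eq_maxValue v x
    rw [← ha]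
    refine (sub_le_sub_left (le_maxValue y a) _).trans ?_
    rw [← Finset.sum_sub_distrib]
    refine Finset.sum_le_sum fun e _ => ?_
    rw [← sub_mul]
    refine (le_abs_self _).trans ?_
    have hva : |v a e| = 1 := by rw [← sq_eq_sq₀ (abs_nonneg _) zero_le_one, sq_abs, hv, one_pow]
    rw [abs_mul, hva, mul_one]
  refine abs_le.2 ⟨?_, key x y⟩
  have := key y x
  simp only [abs_sub_comm (y _)] at this
  linarith

theorem abs_maxValue_le [Nonempty S] (hv : ∀ a e, v a e ^ 2 = 1) (x : ι → ℝ) :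
    |maxValue v x| ≤ ∑ e, |x e| := by
  have := abs_maxValue_sub_le hv x 0
  have h0 : maxValue v 0 = 0 := by simp [maxValue]
  simpa [h0] using this

theorem measurable_maxValue [Nonempty S] (hv : ∀ a e, v a e ^ 2 = 1) :
    Measurable (maxValue v) := by
  have : LipschitzWith (Fintype.card ι) (maxValue v) := LipschitzWith.of_dist_le_mul fun x y => by
    rw [Real.dist_eq]
    refine (abs_maxValue_sub_le hv x y).trans ?_
    refine (Finset.sum_le_card_nsmul _ _ (dist x y) fun e _ => ?_).trans (by simp)
    simpa [Real.dist_eq] using dist_le_pi_dist x y e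
  exact this.continuous.measurable

theorem sum_gibbsWeight_mul_le_maxValue {T : Finset S} (hT : T.Nonempty) {lam : ℝ}
    (w y : ι → ℝ) : ∑ a ∈ T, gibbsWeight T v lam a w * ∑ e, y e * v a e ≤ maxValue v y := by
  calc _ ≤ ∑ a ∈ T, gibbsWeight T v lam a w * maxValue v y :=
        Finset.sum_le_sum fun a _ =>
          mul_le_mul_of_nonneg_left (le_maxValue y a) (gibbsWeight_nonneg a w)
    _ = _ := by rw [← Finset.sum_mul, sum_gibbsWeight hT, one_mul]

theorem integral_eval_gaussian (e : ι) :
    ∫ w, w e ∂(Measure.pi fun _ : ι => gaussianReal 0 1) = 0 := by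
  have := integral_comp_eval (μ := fun _ : ι => gaussianReal 0 1) (i := e) (f := fun t : ℝ => t)
    (by fun_prop)
  rw [this, integral_id_gaussianReal]

theorem integrable_maxValue_add_mul [Nonempty S] (hv : ∀ a e, v a e ^ 2 = 1) (x : ι → ℝ) (s : ℝ) :
    Integrable (fun w => maxValue v fun e => x e + s * w e)
      (Measure.pi fun _ : ι => gaussianReal 0 1) := by
  refine Integrable.mono' (g := fun w => ∑ e, (|x e| + |s| * |w e|)) ?_
    ((measurable_maxValue hv).comp (by fun_prop)).aestronglyMeasurable
    (Eventually.of_forall fun w => (abs_maxValue_le hv _).trans ?_)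
  · exact integrable_finsetSum _ fun e _ =>
      (integrable_const _).add ((integrable_eval_gaussian e).abs.const_mul _)
  · refine Finset.sum_le_sum fun e _ => (abs_add_le _ _).trans ?_
    rw [abs_mul]

/-- A centred Gaussian perturbation does not decrease the mean of the maximum. -/
theorem maxValue_le_integral_add_mul [Nonempty S] (hv : ∀ a e, v a e ^ 2 = 1) (x : ι → ℝ)
    (s : ℝ) :
    maxValue v x ≤ ∫ w, maxValue v (fun e => x e + s * w e)
      ∂(Measure.pi fun _ : ι => gaussianReal 0 1) := by
  obtain ⟨a, ha⟩ := exists_eq_maxValue v x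
  have hi : ∀ e, Integrable (fun w : ι → ℝ => (x e + s * w e) * v a e)
      (Measure.pi fun _ : ι => gaussianReal 0 1) := fun e =>
    ((integrable_const _).add ((integrable_eval_gaussian e).const_mul s)).mul_const _
  have h1 := integral_mono (integrable_finsetSum Finset.univ fun e _ => hi e)
    (integrable_maxValue_add_mul hv x s) (fun w => le_maxValue (fun e => x e + s * w e) a)
  rw [integral_finsetSum _ fun e _ => hi e] at h1
  rw [← ha]
  refine le_trans (le_of_eq (Finset.sum_congr rfl fun e _ => ?_)) h1
  rw [integral_mul_const, integral_add (integrable_const _)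
    ((integrable_eval_gaussian e).const_mul s), integral_const_mul, integral_eval_gaussian]
  simp

/-- If many well-separated configurations are within `κ` of the maximum, then a Gaussian
perturbation of size `s` increases the mean of the maximum substantially. -/
theorem maxValue_add_le_integral_add_mul [Nonempty S] (hv : ∀ a e, v a e ^ 2 = 1) (x : ι → ℝ)
    {s lam r κ : ℝ} (hs : 0 ≤ s) (hlam : 0 ≤ lam) (hr : 0 ≤ r) {T : Finset S}
    (hclose : ∀ a ∈ T, (T.filter fun b => ∑ e, (1 - v a e * v b e) < r).card ≤ 2)
    (hcard : 4 * Real.exp (8 * lam ^ 2 * Fintype.card ι) ≤ T.card)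
    (hnear : ∀ a ∈ T, maxValue v x - κ ≤ ∑ e, x e * v a e) :
    maxValue v x + (s * (lam * r / 2) - κ) ≤ ∫ w, maxValue v (fun e => x e + s * w e)
      ∂(Measure.pi fun _ : ι => gaussianReal 0 1) := by
  have hm : (0 : ℝ) < T.card := lt_of_lt_of_le (by positivity) hcard
  have hT : T.Nonempty := Finset.card_pos.1 (by exact_mod_cast hm)
  let E : (ι → ℝ) → ℝ := fun w => ∑ a ∈ T, gibbsWeight T v lam a w * ∑ e, w e * v a e
  have hEi : Integrable E (Measure.pi fun _ : ι => gaussianReal 0 1) := by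
    refine integrable_finsetSum _ fun a ha => ?_
    have : (fun w : ι → ℝ => gibbsWeight T v lam a w * ∑ e, w e * v a e) =
        fun w => ∑ e, (w e * gibbsWeight T v lam a w) * v a e := by
      funext w
      rw [Finset.mul_sum]
      exact Finset.sum_congr rfl fun e _ => by ring
    rw [this]
    exact integrable_finsetSum _ fun e _ =>
      (integrable_eval_mul_of_abs_le e (measurable_gibbsWeight a) 1 fun w => by
        rw [abs_of_nonneg (gibbsWeight_nonneg a w)]
        exact gibbsWeight_le_one ha w).mul_const _
  have hpt : ∀ w, maxValue v x - κ + s * E w ≤ maxValue v (fun e => x e + s * w e) := fun w => by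
    refine le_trans ?_ (sum_gibbsWeight_mul_le_maxValue hT (lam := lam) w _)
    have h1 : ∀ a, ∑ e, (x e + s * w e) * v a e =
        ∑ e, x e * v a e + s * ∑ e, w e * v a e := fun a => by
      rw [Finset.mul_sum, ← Finset.sum_add_distrib]
      exact Finset.sum_congr rfl fun e _ => by ring
    have h2 : ∑ a ∈ T, gibbsWeight T v lam a w * (maxValue v x - κ) = maxValue v x - κ := by
      rw [← Finset.sum_mul, sum_gibbsWeight hT, one_mul]
    rw [← h2]
    simp only [E, h1, mul_add, Finset.sum_add_distrib]
    refine add_le_add (Finset.sum_le_sum fun a ha =>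
      mul_le_mul_of_nonneg_left (hnear a ha) (gibbsWeight_nonneg a w)) (le_of_eq ?_)
    rw [Finset.mul_sum]
    exact Finset.sum_congr rfl fun a _ => by ring
  have h1 : ∫ w, (maxValue v x - κ + s * E w) ∂(Measure.pi fun _ : ι => gaussianReal 0 1) ≤ _ :=
    integral_mono ((integrable_const _).add (hEi.const_mul s))
      (integrable_maxValue_add_mul hv x s) hpt
  rw [integral_add (integrable_const _) (hEi.const_mul s), integral_const_mul] at h1
  simp only [integral_const, probReal_univ, smul_eq_mul, one_mul] at h1
  have h2 := mul_le_mul_of_nonneg_left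
    (le_integral_sum_gibbsWeight_mul hv hlam hr hclose hcard) hs
  linarith

theorem measurableSet_near_maximizers [Nonempty S] (hv : ∀ a e, v a e ^ 2 = 1)
    (𝒯 : Set (Finset S)) (κ : ℝ) :
    MeasurableSet {x | ∃ T ∈ 𝒯, ∀ a ∈ T, maxValue v x - κ ≤ ∑ e, x e * v a e} := by
  have : {x | ∃ T ∈ 𝒯, ∀ a ∈ T, maxValue v x - κ ≤ ∑ e, x e * v a e} =
      ⋃ T ∈ 𝒯, ⋂ a ∈ T, {x | maxValue v x - κ ≤ ∑ e, x e * v a e} := by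
    ext x
    simp
  rw [this]
  exact MeasurableSet.biUnion (Set.to_countable _) fun T _ =>
    Finset.measurableSet_biInter _ fun a _ =>
      measurableSet_le ((measurable_maxValue hv).sub_const κ) (by fun_prop)

/-- Many well-separated near-maximizers are unlikely: the gain that a Gaussian perturbation of the
disorder would extract from them is limited by the almost-invariance of the disorder law under
that perturbation. -/
theorem measureReal_near_maximizers_mul_le [Nonempty S] (hv : ∀ a e, v a e ^ 2 = 1)
    {P : Measure ℝ} [IsProbabilityMeasure P] (hP : Integrable (fun x : ℝ => x) P)
    {s lam r κ η : ℝ} (hs : 0 ≤ s) (hlam : 0 ≤ lam) (hr : 0 ≤ r)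
    (hη : ∀ g : ℝ → ℝ, (∀ a b, |g a - g b| ≤ |a - b|) →
      ∫ x, g x ∂((P.prod (gaussianReal 0 1)).map fun z => z.1 + s * z.2) ≤ ∫ x, g x ∂P + η)
    {𝒯 : Set (Finset S)}
    (hclose : ∀ T ∈ 𝒯, ∀ a ∈ T, (T.filter fun b => ∑ e, (1 - v a e * v b e) < r).card ≤ 2)
    (hcard : ∀ T ∈ 𝒯, 4 * Real.exp (8 * lam ^ 2 * Fintype.card ι) ≤ T.card) :
    (Measure.pi fun _ : ι => P).real
        {x | ∃ T ∈ 𝒯, ∀ a ∈ T, maxValue v x - κ ≤ ∑ e, x e * v a e} *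
      (s * (lam * r / 2) - κ) ≤ Fintype.card ι * η := by
  set B := {x | ∃ T ∈ 𝒯, ∀ a ∈ T, maxValue v x - κ ≤ ∑ e, x e * v a e} with hB
  have hBm : MeasurableSet B := measurableSet_near_maximizers hv 𝒯 κ
  set Δ := s * (lam * r / 2) - κ with hΔ
  have hmm := measurable_maxValue hv
  have hsm : Measurable fun z : ℝ × ℝ => z.1 + s * z.2 := by fun_prop
  have := Measure.isProbabilityMeasure_map (μ := P.prod (gaussianReal 0 1)) hsm.aemeasurable
  have hν : Integrable (fun x : ℝ => x)
      ((P.prod (gaussianReal 0 1)).map fun z => z.1 + s * z.2) := by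
    rw [integrable_map_measure (by fun_prop) hsm.aemeasurable]
    exact (hP.comp_fst _).add ((((memLp_id_gaussianReal (μ := 0) (v := 1) 1).integrable
      le_rfl).comp_snd P).const_mul s)
  have h1 := integral_pi_le_of_lipschitz (ι := ι) P _ hP hν hη hmm (abs_maxValue_le hv)
    (abs_maxValue_sub_le hv)
  have hsum : Measurable fun p : (ι → ℝ) × (ι → ℝ) => fun e => p.1 e + s * p.2 e := by fun_prop
  have hi : Integrable (maxValue v)
      (Measure.pi fun _ : ι => (P.prod (gaussianReal 0 1)).map fun z => z.1 + s * z.2) :=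
    integrable_pi_of_abs_le_sum (fun _ => hν) hmm (abs_maxValue_le hv)
  have hiP : Integrable (maxValue v) (Measure.pi fun _ : ι => P) :=
    integrable_pi_of_abs_le_sum (fun _ => hP) hmm (abs_maxValue_le hv)
  rw [← map_add_mul_pi_prod_pi] at h1 hi
  rw [integral_map hsum.aemeasurable hmm.aestronglyMeasurable] at h1
  have hi' : Integrable
      (fun p : (ι → ℝ) × (ι → ℝ) => maxValue v (fun e => p.1 e + s * p.2 e))
      ((Measure.pi fun _ : ι => P).prod (Measure.pi fun _ : ι => gaussianReal 0 1)) :=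
    hi.comp_measurable hsum
  have h2 : ∫ x, (maxValue v x + B.indicator (fun _ => Δ) x) ∂(Measure.pi fun _ : ι => P) ≤
      ∫ p : (ι → ℝ) × (ι → ℝ), maxValue v (fun e => p.1 e + s * p.2 e)
        ∂((Measure.pi fun _ : ι => P).prod (Measure.pi fun _ : ι => gaussianReal 0 1)) := by
    rw [integral_prod _ hi']
    refine integral_mono (hiP.add ((integrable_const Δ).indicator hBm)) hi'.integral_prod_left
      fun x => ?_
    by_cases hx : x ∈ B
    · obtain ⟨T, hT, hnear⟩ := hx
      simp only [Set.indicator_of_mem (show x ∈ B from ⟨T, hT, hnear⟩)]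
      exact maxValue_add_le_integral_add_mul hv x hs hlam hr (hclose T hT) (hcard T hT) hnear
    · simp only [Set.indicator_of_notMem hx, add_zero]
      exact maxValue_le_integral_add_mul hv x s
  rw [integral_add hiP ((integrable_const Δ).indicator hBm), integral_indicator_const _ hBm,
    smul_eq_mul] at h2
  linarith

end

/-! ### Geometry of the spin configurations -/

instance (n : ℕ) : Finite (SKConfig n) :=
  inferInstanceAs (Finite {σ : Fin n → ℤˣ // ∀ i : Fin n, (i : ℕ) = 0 → σ i = 1})

/-- The products `σ_i σ_j` over the pairs `i < j`: the coefficients of the disorder variables in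
minus the Hamiltonian. -/
noncomputable def skSign (n : ℕ) (σ : SKConfig n) (p : SKPair n) : ℝ :=
  ((σ.1 p.1.1 : ℤ) : ℝ) * ((σ.1 p.1.2 : ℤ) : ℝ)

theorem skHamiltonian_eq (n : ℕ) (x : SKPair n → ℝ) (σ : SKConfig n) :
    skHamiltonian n x σ = -∑ p, x p * skSign n σ p := by
  simp only [skHamiltonian, skSign, mul_assoc]

theorem intUnits_cast_sq (u : ℤˣ) : ((u : ℤ) : ℝ) ^ 2 = 1 := by
  rcases Int.units_eq_one_or u with rfl | rfl <;> norm_num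

theorem skSign_sq (n : ℕ) (σ : SKConfig n) (p : SKPair n) : skSign n σ p ^ 2 = 1 := by
  rw [skSign, mul_pow, intUnits_cast_sq, intUnits_cast_sq, one_mul]

theorem sum_skPair {n : ℕ} (g : Fin n → Fin n → ℝ) (hsymm : ∀ i j, g i j = g j i)
    (hdiag : ∀ i, g i i = 0) : 2 * ∑ p : SKPair n, g p.1.1 p.1.2 = ∑ i, ∑ j, g i j := by
  have h1 : ∑ p : SKPair n, g p.1.1 p.1.2 =
      ∑ p : Fin n × Fin n, if p.1 < p.2 then g p.1 p.2 else 0 := by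
    rw [← Finset.sum_filter]
    exact (Finset.sum_subtype _ (fun p => by simp) (fun p : Fin n × Fin n => g p.1 p.2)).symm
  have h2 : ∑ p : Fin n × Fin n, (if p.1 < p.2 then g p.1 p.2 else 0) =
      ∑ p : Fin n × Fin n, if p.2 < p.1 then g p.1 p.2 else 0 := by
    rw [← (Equiv.prodComm (Fin n) (Fin n)).sum_comp]
    exact Finset.sum_congr rfl fun p _ => by simp [hsymm p.2 p.1]
  rw [two_mul, h1]
  nth_rewrite 2 [h2]
  rw [← Finset.sum_add_distrib, ← Fintype.sum_prod_type']
  refine Finset.sum_congr rfl fun p _ => ?_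
  rcases lt_trichotomy p.1 p.2 with h | h | h
  · simp [h, h.not_gt]
  · simp [h, hdiag]
  · simp [h, h.not_gt]

/-- Two configurations at Hamming distance `k` disagree on the `k (n - k)` pairs of sites of which
exactly one was flipped. -/
theorem sum_one_sub_skSign_mul (n : ℕ) (σ τ : SKConfig n) :
    ∑ p, (1 - skSign n σ p * skSign n τ p) =
      2 * hammingDist σ.1 τ.1 * (n - hammingDist σ.1 τ.1) := by
  let u : Fin n → ℝ := fun i => ((σ.1 i : ℤ) : ℝ) * ((τ.1 i : ℤ) : ℝ)
  have hu : ∀ i, u i ^ 2 = 1 := fun i => by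
    simp only [u, mul_pow, intUnits_cast_sq, one_mul]
  have h1 := sum_skPair (fun i j => 1 - u i * u j) (fun i j => by ring)
    (fun i => by linear_combination -hu i)
  have h2 : ∑ p, (1 - skSign n σ p * skSign n τ p) = ∑ p : SKPair n, (1 - u p.1.1 * u p.1.2) :=
    Finset.sum_congr rfl fun p _ => by simp only [skSign, u]; ring
  have h3 : ∑ i, u i = n - 2 * hammingDist σ.1 τ.1 := by
    have h4 : ∀ i, u i = 1 - 2 * if σ.1 i ≠ τ.1 i then 1 else 0 := fun i => by
      simp only [u]
      rcases Int.units_eq_one_or (σ.1 i) with h | h <;>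
        rcases Int.units_eq_one_or (τ.1 i) with h' | h' <;> norm_num [h, h']
    simp only [h4, Finset.sum_sub_distrib, ← Finset.mul_sum, Finset.sum_boole, hammingDist]
    simp
  have h5 : ∑ i, ∑ j, (1 - u i * u j) = (n : ℝ) ^ 2 - (∑ i, u i) ^ 2 := by
    simp only [Finset.sum_sub_distrib, ← Finset.mul_sum, ← Finset.sum_mul]
    simp
    ring
  rw [h2]
  rw [h5, h3] at h1
  linarith

theorem hammingDist_le_of_units {n : ℕ} (a b c : Fin n → ℤˣ) :
    hammingDist b c + (hammingDist a b + hammingDist a c) ≤ 2 * n := by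
  have h : ∀ i, (if b i ≠ c i then 1 else 0) + ((if a i ≠ b i then 1 else 0) +
      if a i ≠ c i then 1 else 0) ≤ 2 := fun i => by
    rcases Int.units_eq_one_or (a i) with h | h <;>
      rcases Int.units_eq_one_or (b i) with h' | h' <;>
        rcases Int.units_eq_one_or (c i) with h'' | h'' <;> rw [h, h', h''] <;> decide
  have := Finset.sum_le_sum fun i (_ : i ∈ Finset.univ) => h i
  simp only [Finset.sum_add_distrib, Finset.sum_boole, Finset.sum_const, Finset.card_univ,
    Fintype.card_fin, smul_eq_mul, Nat.cast_id] at this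
  simp only [hammingDist]
  linarith

/-- In a separated set of configurations, the only configurations whose energies are strongly
correlated with that of `a` are `a` and at most one configuration close to its global flip. -/
theorem card_filter_sum_one_sub_skSign_le {n : ℕ} {ε : ℝ} (hn : 0 < n) (hε : 0 < ε)
    {T : Finset (SKConfig n)} (hT : (T : Set (SKConfig n)).Pairwise fun σ τ => ε < dist σ τ)
    {a : SKConfig n} (ha : a ∈ T) :
    (T.filter fun b => ∑ p, (1 - skSign n a p * skSign n b p) < ε ^ 2 * n ^ 2).card ≤ 2 := by
  classical
  have hn' : (0 : ℝ) < n := by exact_mod_cast hn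
  have hsep : ∀ b ∈ T, ∀ c ∈ T, b ≠ c → ε * n < hammingDist b.1 c.1 := fun b hb c hc hbc =>
    (lt_div_iff₀ hn').1 (hT hb hc hbc)
  have hfar : ∀ b ∈ T, b ≠ a → ∑ p, (1 - skSign n a p * skSign n b p) < ε ^ 2 * n ^ 2 →
      (n : ℝ) - hammingDist a.1 b.1 < ε * n / 2 := fun b hb hba h => by
    rw [sum_one_sub_skSign_mul] at h
    have h1 := hsep a ha b hb hba.symm
    have h2 : (0 : ℝ) < ε * n := by positivity
    by_contra! h3
    nlinarith
  set F := T.filter fun b => ∑ p, (1 - skSign n a p * skSign n b p) < ε ^ 2 * n ^ 2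
  have h1 : (F.erase a).card ≤ 1 := by
    refine Finset.card_le_one.2 fun b hb c hc => ?_
    simp only [F, Finset.mem_erase, Finset.mem_filter] at hb hc
    by_contra hbc
    have h2 := hsep b hb.2.1 c hc.2.1 hbc
    have h3 := hfar b hb.2.1 hb.1 hb.2.2
    have h4 := hfar c hc.2.1 hc.1 hc.2.2
    have h5 : (hammingDist b.1 c.1 : ℝ) + (hammingDist a.1 b.1 + hammingDist a.1 c.1) ≤ 2 * n := by
      exact_mod_cast hammingDist_le_of_units a.1 b.1 c.1
    linarith
  have := Finset.pred_card_le_card_erase (s := F) (a := a)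
  omega

theorem card_skPair_le (n : ℕ) : (Fintype.card (SKPair n) : ℝ) ≤ n ^ 2 := by
  have := Fintype.card_subtype_le fun p : Fin n × Fin n => p.1 < p.2
  simp only [Fintype.card_prod, Fintype.card_fin] at this
  rw [sq]
  exact_mod_cast this

/-! ### Uniqueness of the ground state -/

theorem ae_sum_mul_ne_zero {ι : Type*} [Fintype ι] (P : Measure ℝ) [IsProbabilityMeasure P]
    [NullSingletonClass P] (c : ι → ℝ) {e : ι} (he : c e ≠ 0) :
    ∀ᵐ x ∂(Measure.pi fun _ : ι => P), ∑ i, x i * c i ≠ 0 := by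
  classical
  have hm : MeasurableSet {x : ι → ℝ | ∑ i, x i * c i ≠ 0} :=
    (measurableSet_eq_fun (by fun_prop) measurable_const).compl
  rw [← map_update_pi_prod (fun _ : ι => P) (fun _ => P) e (fun _ _ => rfl),
    ae_map_iff (measurable_update_prod e).aemeasurable hm]
  refine (Measure.ae_prod_iff_ae_ae (measurable_update_prod e hm)).2 ?_
  refine Eventually.of_forall fun x => ?_
  rw [ae_iff]
  refine measure_mono_null (t := {-(∑ i ∈ Finset.univ.erase e, x i * c i) / c e})
    (fun t ht => ?_) (measure_singleton _)
  simp only [ne_eq, not_not, Set.mem_ofPred_eq] at ht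
  rw [← Finset.add_sum_erase _ _ (Finset.mem_univ e), Function.update_self] at ht
  have h1 : ∑ i ∈ Finset.univ.erase e, Function.update x e t i * c i =
      ∑ i ∈ Finset.univ.erase e, x i * c i :=
    Finset.sum_congr rfl fun i hi => by rw [Function.update_of_ne (Finset.ne_of_mem_erase hi)]
  rw [h1] at ht
  rw [Set.mem_singleton_iff, eq_div_iff he]
  linarith

theorem exists_skSign_ne {n : ℕ} {σ τ : SKConfig n} (h : σ ≠ τ) :
    ∃ p, skSign n σ p ≠ skSign n τ p := by
  obtain ⟨j, hj⟩ : ∃ j, σ.1 j ≠ τ.1 j := by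
    by_contra! h'
    exact h (Subtype.ext (funext h'))
  have hn : 0 < n := j.pos
  have hj0 : (⟨0, hn⟩ : Fin n) < j := by
    rw [Fin.lt_def]
    refine Nat.pos_of_ne_zero fun h0 => hj ?_
    rw [σ.2 j h0, τ.2 j h0]
  refine ⟨⟨(⟨0, hn⟩, j), hj0⟩, ?_⟩
  simp only [skSign, σ.2 ⟨0, hn⟩ rfl, τ.2 ⟨0, hn⟩ rfl]
  simpa [Units.val_inj] using hj

theorem hasUniqueOptimizer_skHamiltonian (P : Measure ℝ) [IsProbabilityMeasure P]
    [NullSingletonClass P] (n : ℕ) : HasUniqueOptimizer P (skHamiltonian n) := by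
  have h : ∀ σ τ : SKConfig n, σ ≠ τ → ∀ᵐ x ∂(Measure.pi fun _ : SKPair n => P),
      skHamiltonian n x σ ≠ skHamiltonian n x τ := fun σ τ hστ => by
    obtain ⟨p, hp⟩ := exists_skSign_ne hστ
    filter_upwards [ae_sum_mul_ne_zero P (fun p => skSign n σ p - skSign n τ p)
      (sub_ne_zero.2 hp)] with x hx heq
    rw [skHamiltonian_eq, skHamiltonian_eq, neg_inj] at heq
    refine hx ?_
    simp only [mul_sub, Finset.sum_sub_distrib, heq, sub_self]
  have h' := ae_all_iff.2 fun σ => ae_all_iff.2 fun τ => eventually_imp_distrib_left.2 (h σ τ)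
  filter_upwards [h'] with x hx
  obtain ⟨σ, hσ⟩ := Finite.exists_min (skHamiltonian n x)
  refine ⟨σ, hσ, fun τ hτ => ?_⟩
  by_contra hne
  exact hx τ σ hne (le_antisymm (hτ σ) (hσ τ))

/-! ### Stability of the ground state -/

/-- The sets of configurations with at least `M` elements, any two of which are more than `ε`
apart. -/
def separatedSets (n M : ℕ) (ε : ℝ) : Set (Finset (SKConfig n)) :=
  {T | M ≤ T.card ∧ (T : Set (SKConfig n)).Pairwise fun σ τ => ε < dist σ τ}

/-- The disorders for which some `M` configurations that are more than `ε` apart have energies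
within `κ` of the ground-state energy. -/
def manyGroundStates (n M : ℕ) (ε κ : ℝ) : Set (SKPair n → ℝ) :=
  {x | ∃ T ∈ separatedSets n M ε, ∀ σ ∈ T,
    maxValue (skSign n) x - κ ≤ ∑ p, x p * skSign n σ p}

theorem isMinimizer_optimizer_skHamiltonian (n : ℕ) (x : SKPair n → ℝ) :
    IsMinimizer (skHamiltonian n x) (optimizer (skHamiltonian n x)) :=
  Classical.epsilon_spec (p := fun σ => IsMinimizer (skHamiltonian n x) σ)
    (Finite.exists_min (skHamiltonian n x))

theorem sum_mul_skSign_optimizer (n : ℕ) (x : SKPair n → ℝ) :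
    ∑ p, x p * skSign n (optimizer (skHamiltonian n x)) p = maxValue (skSign n) x := by
  refine le_antisymm (le_maxValue x _) (ciSup_le fun σ => ?_)
  have := isMinimizer_optimizer_skHamiltonian n x σ
  rw [skHamiltonian_eq, skHamiltonian_eq] at this
  linarith

/-- The ground state after the replacement of one disorder variable is nearly optimal for the
original disorder. -/
theorem maxValue_sub_le_optimizer_perturbedInput {n : ℕ} (x x' : SKPair n → ℝ) (l : SKPair n)
    {K : ℝ} (hK : |x l - x' l| ≤ K) :
    maxValue (skSign n) x - 2 * K ≤
      ∑ p, x p * skSign n (optimizer (skHamiltonian n (perturbedInput {l} x x'))) p := by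
  set y := perturbedInput {l} x x' with hy
  set σ := optimizer (skHamiltonian n y)
  have hxy : ∑ p, |x p - y p| = |x l - x' l| := by
    rw [Finset.sum_eq_single l]
    · simp [hy, perturbedInput]
    · intro p _ hp
      simp [hy, perturbedInput, hp]
    · simp
  have h1 := (abs_le.1 (abs_maxValue_sub_le (skSign_sq n) x y)).2
  have h2 : ∑ p, y p * skSign n σ p - ∑ p, x p * skSign n σ p ≤ ∑ p, |x p - y p| := by
    rw [← Finset.sum_sub_distrib]
    refine Finset.sum_le_sum fun p _ => ?_
    have hσ : |skSign n σ p| = 1 := by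
      rw [← sq_eq_sq₀ (abs_nonneg _) zero_le_one, sq_abs, skSign_sq, one_pow]
    rw [← sub_mul, abs_sub_comm]
    refine (le_abs_self _).trans ?_
    rw [abs_mul, hσ, mul_one]
  have h3 : ∑ p, y p * skSign n σ p = maxValue (skSign n) y := sum_mul_skSign_optimizer n y
  rw [hxy] at h1 h2
  linarith

theorem minPacking_le_packingNumber {S L : Type} [MetricSpace S] [Fintype L] {ε : ℝ≥0}
    (ω : L → S) (A : Finset L) (hA : (1 - (ε : ℝ)) * (Fintype.card L : ℝ) < (A.card : ℝ)) :
    minPacking ε ω ≤ Metric.packingNumber ε (ω '' (A : Set L)) :=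
  iInf_le (fun A : {A : Finset L // (1 - (ε : ℝ)) * (Fintype.card L : ℝ) < (A.card : ℝ)} =>
    Metric.packingNumber ε (ω '' (A.1 : Set L))) ⟨A, hA⟩

/-- If the perturbed ground states have large packing number for all large sets of perturbed
variables, then either many replacements were large or many separated configurations are nearly
optimal. -/
theorem mem_manyGroundStates_or_of_le_minPacking {n M : ℕ} {ε : ℝ≥0} {K : ℝ} (hK : 0 < K)
    (x : SKPair n → ℝ) (x' : SKPair n → SKPair n → ℝ)
    (h : (M : ℕ∞) ≤ minPacking ε fun l =>
      optimizer (skHamiltonian n (perturbedInput {l} x (x' l)))) :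
    x ∈ manyGroundStates n M ε (2 * K) ∨
      ε * Fintype.card (SKPair n) * K ≤ ∑ l, |x l - x' l l| := by
  classical
  refine or_iff_not_imp_right.2 fun hbig => ?_
  rw [not_le] at hbig
  let ω : SKPair n → SKConfig n := fun l =>
    optimizer (skHamiltonian n (perturbedInput {l} x (x' l)))
  let A : Finset (SKPair n) := Finset.univ.filter fun l => |x l - x' l l| ≤ K
  have hA : (1 - (ε : ℝ)) * (Fintype.card (SKPair n) : ℝ) < A.card := by
    have h1 : (Aᶜ.card : ℝ) * K ≤ ∑ l, |x l - x' l l| := by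
      rw [← nsmul_eq_mul]
      refine (Finset.card_nsmul_le_sum _ _ _ fun l hl => ?_).trans
        (Finset.sum_le_univ_sum_of_nonneg fun l => abs_nonneg _)
      simp only [A, Finset.mem_compl, Finset.mem_filter, Finset.mem_univ, true_and, not_le] at hl
      exact hl.le
    have h2 : (Aᶜ.card : ℝ) < ε * Fintype.card (SKPair n) :=
      lt_of_mul_lt_mul_right (h1.trans_lt hbig) hK.le
    have h3 : (A.card : ℝ) + Aᶜ.card = Fintype.card (SKPair n) := by
      exact_mod_cast Finset.card_add_card_compl A
    linarith
  have hpack : (M : ℕ∞) ≤ Metric.packingNumber ε (ω '' (A : Set (SKPair n))) :=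
    h.trans (minPacking_le_packingNumber ω A hA)
  have hfin : Metric.packingNumber ε (ω '' (A : Set (SKPair n))) ≠ ⊤ :=
    ((Metric.packingNumber_le_encard_self _).trans_lt (Set.toFinite _).encard_lt_top).ne
  obtain ⟨C, hCA, hCfin, hCsep, hCcard⟩ := Metric.exists_set_encard_eq_packingNumber hfin
  refine ⟨hCfin.toFinset, ⟨?_, ?_⟩, fun σ hσ => ?_⟩
  · rw [← hCcard, hCfin.encard_eq_coe_toFinset_card] at hpack
    exact_mod_cast hpack
  · rw [hCfin.coe_toFinset]
    intro σ hσ τ hτ hne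
    have : (ε : ℝ≥0∞) < edist σ τ := hCsep hσ hτ hne
    rw [edist_nndist, ENNReal.coe_lt_coe] at this
    exact_mod_cast this
  · obtain ⟨l, hl, rfl⟩ := hCA (hCfin.mem_toFinset.1 hσ)
    exact maxValue_sub_le_optimizer_perturbedInput x (x' l) l (Finset.mem_filter.1 hl).2

/-- The probability of many nearly optimal configurations is bounded uniformly in the system size
`n`: under perturbations of size `1 / n` the drift of the ground-state energy stays bounded, because
there are at most `n ^ 2` disorder variables, and so does the Gaussian gain, because energies of
separated configurations have fluctuations of order `n`. -/
theorem measureReal_manyGroundStates_mul_le {P : Measure ℝ} [IsProbabilityMeasure P] {f : ℝ → ℝ}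
    (hf_meas : Measurable f) (hf_nonneg : ∀ x, 0 ≤ f x)
    (hf_density : P = volume.withDensity fun x => ENNReal.ofReal (f x))
    (hP : Integrable (fun x : ℝ => x) P) {C : ℝ} (hC : 0 < C)
    (hf : ∀ s : ℝ, 0 ≤ s →
      ∫⁻ z, ENNReal.ofReal (|z.2| * max (1 - f (z.1 + s * z.2) / f z.1) 0)
        ∂(P.prod (gaussianReal 0 1)) ≤ ENNReal.ofReal (C * s))
    {n M : ℕ} (hn : 0 < n) {ε κ t : ℝ} (hε : 0 < ε) (ht : 0 ≤ t)
    (hM : 4 * Real.exp (8 * t ^ 2) ≤ M) :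
    (Measure.pi fun _ : SKPair n => P).real (manyGroundStates n M ε κ) *
      (t * ε ^ 2 / 2 - κ) ≤ C := by
  have hn' : (0 : ℝ) < n := by exact_mod_cast hn
  have hs : (0 : ℝ) ≤ (n : ℝ)⁻¹ := by positivity
  have hN := card_skPair_le n
  -- inverse temperature `t / n`, perturbation size `1 / n`, squared separation of order `n ^ 2`
  have key := measureReal_near_maximizers_mul_le (κ := κ) (lam := t / n) (r := ε ^ 2 * n ^ 2)
    (𝒯 := separatedSets n M ε) (skSign_sq n) hP hs (by positivity) (by positivity)
    (fun g hg => integral_map_add_mul_le hf_meas hf_nonneg hf_density hP hC hs (hf _ hs) hg)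
    (fun T hT a ha => card_filter_sum_one_sub_skSign_le hn hε hT.2 ha)
    (fun T hT => by
      have h1 : (M : ℝ) ≤ T.card := by exact_mod_cast hT.1
      refine le_trans ?_ (hM.trans h1)
      refine mul_le_mul_of_nonneg_left (Real.exp_le_exp.2 ?_) (by norm_num)
      rw [div_pow, mul_assoc]
      refine mul_le_mul_of_nonneg_left ?_ (by norm_num)
      rw [div_mul_eq_mul_div, div_le_iff₀ (by positivity)]
      exact mul_le_mul_of_nonneg_left hN (sq_nonneg t))
  have h1 : (n : ℝ)⁻¹ * (t / n * (ε ^ 2 * n ^ 2) / 2) = t * ε ^ 2 / 2 := by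
    field_simp
  rw [h1] at key
  refine key.trans ?_
  calc (Fintype.card (SKPair n) : ℝ) * (C * (n : ℝ)⁻¹ ^ 2) ≤ n ^ 2 * (C * (n : ℝ)⁻¹ ^ 2) := by
        gcongr
    _ = C := by field_simp

/-- Markov's inequality: large replacements are controlled by the first moment of the disorder. -/
theorem measureReal_sum_abs_sub_ge_le {ι Ω : Type*} [Fintype ι] [MeasurableSpace Ω]
    {μ : Measure Ω} [IsProbabilityMeasure μ] {P : Measure ℝ} [IsProbabilityMeasure P]
    (hP : Integrable (fun x : ℝ => x) P) {X : Ω → ι → ℝ} {X' : ι → Ω → ι → ℝ}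
    (hX : HasLaw X (Measure.pi fun _ => P) μ)
    (hX' : ∀ l, HasLaw (X' l) (Measure.pi fun _ => P) μ) (c : ℝ) :
    c * μ.real {a | c ≤ ∑ l, |X a l - X' l a l|} ≤ Fintype.card ι * (2 * ∫ x, |x| ∂P) := by
  have hlaw : ∀ {Y : Ω → ι → ℝ}, HasLaw Y (Measure.pi fun _ => P) μ → ∀ l,
      HasLaw (fun a => Y a l) P μ := fun {Y} hY l =>
    (⟨(measurable_pi_apply l).aemeasurable,
      (measurePreserving_eval (fun _ : ι => P) l).map_eq⟩ :
        HasLaw (Function.eval l) P (Measure.pi fun _ : ι => P)).comp hY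
  have hint : ∀ {Y : Ω → ℝ}, HasLaw Y P μ → Integrable (fun a => |Y a|) μ := fun {Y} hY => by
    have h1 : Integrable (fun x : ℝ => x) (μ.map Y) := by rw [hY.map_eq]; exact hP
    exact (h1.comp_aemeasurable hY.aemeasurable).abs
  have hval : ∀ {Y : Ω → ℝ}, HasLaw Y P μ → ∫ a, |Y a| ∂μ = ∫ x, |x| ∂P := fun {Y} hY => by
    rw [← hY.map_eq, integral_map hY.aemeasurable (by fun_prop)]
  have hi1 : ∀ l, Integrable (fun a => |X a l|) μ := fun l => hint (hlaw hX l)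
  have hi2 : ∀ l, Integrable (fun a => |X' l a l|) μ := fun l => hint (hlaw (hX' l) l)
  have hi : ∀ l, Integrable (fun a => |X a l - X' l a l|) μ := fun l =>
    Integrable.mono' ((hi1 l).add (hi2 l))
      ((hlaw hX l).aemeasurable.sub (hlaw (hX' l) l).aemeasurable).abs.aestronglyMeasurable
      (Eventually.of_forall fun a => by simpa using abs_sub (X a l) (X' l a l))
  refine (mul_meas_ge_le_integral_of_nonneg
    (Eventually.of_forall fun a => Finset.sum_nonneg fun l _ => abs_nonneg _)
    (integrable_finsetSum _ fun l _ => hi l) c).trans ?_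
  rw [integral_finsetSum _ fun l _ => hi l, ← nsmul_eq_mul, ← Finset.card_univ]
  refine Finset.sum_le_card_nsmul _ _ _ fun l _ => ?_
  calc _ ≤ ∫ a, (|X a l| + |X' l a l|) ∂μ :=
        integral_mono (hi l) ((hi1 l).add (hi2 l)) fun a => abs_sub _ _
    _ = _ := by
        rw [integral_add (hi1 l) (hi2 l), hval (hlaw hX l), hval (hlaw (hX' l) l)]
        ring

theorem measurableSet_manyGroundStates (n M : ℕ) (ε κ : ℝ) :
    MeasurableSet (manyGroundStates n M ε κ) :=
  measurableSet_near_maximizers (skSign_sq n) _ _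

/-- Outside two events of probability at most `δ / 2`, most single-variable perturbations keep the
ground state in a set of nearly optimal configurations that has small packing number. -/
theorem stableUnderSmallPerturbations_skHamiltonian {P : Measure ℝ} [IsProbabilityMeasure P]
    {f : ℝ → ℝ} (hf_meas : Measurable f) (hf_nonneg : ∀ x, 0 ≤ f x)
    (hf_density : P = volume.withDensity fun x => ENNReal.ofReal (f x))
    (hP : Integrable (fun x : ℝ => x) P) (hf : SmallRejectionProbability P f) :
    StableUnderSmallPerturbations.{u} P SKPair SKConfig skHamiltonian SKPair
      (fun _ e => {e}) := by
  intro ε δ hε hδ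
  obtain ⟨C, hC, hfC⟩ := hf 1 zero_le_one
  simp only [Real.rpow_one] at hfC
  have hε' : (0 : ℝ) < ε := hε
  have hδ' : (0 : ℝ) < δ := hδ
  set m : ℝ := ∫ x, |x| ∂P with hm
  have hm0 : 0 ≤ m := integral_nonneg fun x => abs_nonneg x
  -- `K` makes large replacements rare; `t` makes the net gain from `M` nearly optimal
  -- configurations equal to `2 * C / δ`
  set K : ℝ := 4 * m / (ε * δ) + 1 with hKdef
  have hK : 0 < K := by positivity
  set t : ℝ := 2 * (2 * K + 2 * C / δ) / ε ^ 2 with htdef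
  have ht : 0 ≤ t := by positivity
  have htε : t * ε ^ 2 / 2 - 2 * K = 2 * C / δ := by
    rw [htdef]
    field_simp
    ring
  refine ⟨⌈4 * Real.exp (8 * t ^ 2)⌉₊, fun Ω _ μ _ X X' hX hX' _ => ?_⟩
  set M := ⌈4 * Real.exp (8 * t ^ 2)⌉₊
  refine limsup_le_of_le (by isBoundedDefault) ?_
  -- for `n < 2` there is no disorder variable, hence no admissible `A`, and `minPacking` is `⊤`
  filter_upwards [eventually_ge_atTop 2] with n hn
  have hN : (0 : ℝ) < Fintype.card (SKPair n) := by
    have : Nonempty (SKPair n) := ⟨⟨(⟨0, by omega⟩, ⟨1, by omega⟩), by simp [Fin.lt_def]⟩⟩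
    exact_mod_cast Fintype.card_pos
  have h1 : μ n (X n ⁻¹' manyGroundStates n M ε (2 * K)) ≤ ENNReal.ofReal (δ / 2) := by
    have hB := measureReal_manyGroundStates_mul_le hf_meas hf_nonneg hf_density hP hC hfC
      (by omega : 0 < n) (κ := 2 * K) hε' ht (Nat.le_ceil (4 * Real.exp (8 * t ^ 2)))
    rw [htε] at hB
    rw [← Measure.map_apply_of_aemeasurable (hX n).aemeasurable
      (measurableSet_manyGroundStates n M ε (2 * K)), (hX n).map_eq]
    refine (ENNReal.le_ofReal_iff_toReal_le (measure_ne_top _ _) (by positivity)).2 ?_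
    change (Measure.pi fun _ : SKPair n => P).real (manyGroundStates n M ε (2 * K)) ≤ _
    have h2 : (0 : ℝ) < 2 * C / δ := by positivity
    rw [← le_div_iff₀ h2] at hB
    refine hB.trans (le_of_eq ?_)
    field_simp
  have h2 : μ n {a | ε * Fintype.card (SKPair n) * K ≤ ∑ l, |X n a l - X' n l a l|} ≤
      ENNReal.ofReal (δ / 2) := by
    have hE := measureReal_sum_abs_sub_ge_le hP (hX n) (hX' n)
      (ε * Fintype.card (SKPair n) * K)
    refine (ENNReal.le_ofReal_iff_toReal_le (measure_ne_top _ _) (by positivity)).2 ?_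
    change (μ n).real _ ≤ _
    have hc : 0 < ε * Fintype.card (SKPair n) * K := by positivity
    have hKm : 2 * m ≤ ε * K * (δ / 2) := by
      have : ε * K * (δ / 2) = 2 * m + ε * (δ / 2) := by
        rw [hKdef]
        field_simp
        ring
      rw [this]
      linarith [show 0 < (ε : ℝ) * (δ / 2) by positivity]
    refine le_of_mul_le_mul_left (hE.trans ?_) hc
    calc (Fintype.card (SKPair n) : ℝ) * (2 * m)
        ≤ Fintype.card (SKPair n) * (ε * K * (δ / 2)) := by gcongr
      _ = _ := by ring
  calc _ ≤ μ n (X n ⁻¹' manyGroundStates n M ε (2 * K) ∪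
        {a | ε * Fintype.card (SKPair n) * K ≤ ∑ l, |X n a l - X' n l a l|}) :=
        measure_mono fun a ha =>
          mem_manyGroundStates_or_of_le_minPacking hK (X n a) (fun l => X' n l a) ha
    _ ≤ ENNReal.ofReal (δ / 2) + ENNReal.ofReal (δ / 2) :=
        (measure_union_le _ _).trans (add_le_add h1 h2)
    _ = δ := by
        rw [← ENNReal.ofReal_add (by positivity) (by positivity), add_halves,
          ENNReal.ofReal_coe_nnreal]

theorem mainTheorem9 (P : Measure ℝ) [IsProbabilityMeasure P] (f : ℝ → ℝ)
    (hf_meas : Measurable f) (hf_nonneg : ∀ x, 0 ≤ f x)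
    (hf_density : P = volume.withDensity fun x => ENNReal.ofReal (f x))
    (hP_integrable : Integrable (fun x : ℝ => x) P) (hP_mean : ∫ x, x ∂P = 0)
    (hf : SmallRejectionProbability P f) :
    (∀ n, HasUniqueOptimizer P (skHamiltonian n)) ∧
      StableUnderSmallPerturbations.{u} P SKPair SKConfig skHamiltonian
        SKPair (fun _ e => {e}) := by
  have hatoms : NullSingletonClass P := ⟨fun x => by
    rw [hf_density]
    exact withDensity_absolutelyContinuous _ _ (measure_singleton x)⟩
  exact ⟨hasUniqueOptimizer_skHamiltonian P,
    stableUnderSmallPerturbations_skHamiltonian hf_meas hf_nonneg hf_density hP_integrable hf⟩
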